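/- **Setting.** Alice holds two systems $A,a$ and Bob holds two systems $B,b$, each with state space $\mathbb{C}^D$. Let $(|\psi_i\rangle)_i$ be a finite family of orthonormal states on $A\otimes B$ and let the blank $|\phi\rangle$ be a unit vector on $a\otimes b$. The family *can be locally cloned with the blank* $|\phi\rangle$ if there are finitely many operators $A_m$ on $A\otimes a$ and $B_m$ on $B\otimes b$ with $\sum_m A_m^\dagger A_m\otimes B_m^\dagger B_m=I$ (a separable operation) such that, for every $i$, $$\sum_m (A_m\otimes B_m)\big(|\psi_i\rangle\langle\psi_i|^{AB}\otimes|\phi\rangle\langle\phi|^{ab}\big)(A_m\otimes B_m)^\dagger=|\psi_i\rangle\langle\psi_i|^{AB}\otimes|\psi_i\rangle\langle\psi_i|^{ab}.$$ A state is entangled if it is not a product vector. The Schmidt coefficients of $\sum_{j,k}c_{jk}|j\rangle|k\rangle$ are the eigenvalues of $cc^\dagger$, where $c=(c_{jk})$, and its Schmidt rank is the number of non-zero ones. A maximally entangled state of Schmidt rank $D$ has exactly $D$ non-zero Schmidt coefficients, all equal to $1/D$. A family $(|\psi_f\rangle)_{f\in G}$, where $G$ is a group of order $D$, is *group-shifted*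 (of full Schmidt rank) if there are orthonormal bases $(|g\rangle^A)_{g\in G}$, $(|g\rangle^B)_{g\in G}$ of $A$ and $B$, numbers $\lambda_g>0$ with $\sum_g\lambda_g=1$, and real phases $\vartheta_{f,g}$ such that either $|\psi_f\rangle=\sum_{g}\sqrt{\lambda_g}\,e^{i\vartheta_{f,g}}|g\rangle^A|fg\rangle^B$ for all $f$, or $|\psi_f\rangle=\sum_{g}\sqrt{\lambda_g}\,e^{i\vartheta_{f,g}}|fg\rangle^A|g\rangle^B$ for all $f$. That a maximally entangled state of Schmidt rank $D$ is *the minimum required resource* for the local cloning of a family means: every blank with which the family can be locally cloned is a maximally entangled state of Schmidt rank $D$; and if the family can be locally cloned with some blank in $\mathbb{C}^D\otimes\mathbb{C}^D$, then it can be locally cloned with every maximally entangled blank of Schmidt rank $D$. **Theorem (Necessity of maximally entangled blank).** (i) A maximally entangled state of Schmidt rank 2 is the minimum required resource for the local cloning of any two orthonormal entangled two-qubit states ($D=2$). (ii) A maximally entangled state of Schmidt rank 3 is the minimum required resource for the local cloning of any three group-shifted two-qutrit states of full Schmidt rank ($D=3$, $|G|=3$). In both cases the states to be cloned may be only partially entangled.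 -/

import Mathlib

open scoped Matrix Kronecker

noncomputable section

/-- The pure (not necessarily normalized) states of a `D × D` bipartite system, written in the
computational product basis; the first index belongs to Alice, the second one to Bob. -/
abbrev BipState (D : ℕ) : Type := EuclideanSpace ℂ (Fin D × Fin D)

/-- The product vector `x ⊗ y`. -/
def productState {D : ℕ} (x y : EuclideanSpace ℂ (Fin D)) : BipState D :=
  WithLp.toLp 2 fun p => x p.1 * y p.2

/-- A bipartite pure state is entangled if it is not a product vector. -/
def IsEntangled {D : ℕ} (χ : BipState D) : Prop :=
  ¬ ∃ x y : EuclideanSpace ℂ (Fin D), χ = productState x y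

/-- The matrix `(c i j)` of the state `∑ i j, c i j • |i⟩ ⊗ |j⟩` (map-state duality). -/
def coeffMatrix {D : ℕ} (χ : BipState D) : Matrix (Fin D) (Fin D) ℂ :=
  Matrix.of fun i j => χ (i, j)

/-- The Schmidt coefficients of `χ` (normalized to have sum `1` on unit vectors): the eigenvalues,
with multiplicity, of `c * cᴴ`, where `c` is the coefficient matrix of `χ`. -/
def schmidtCoeff {D : ℕ} (χ : BipState D) : Fin D → ℝ :=
  (Matrix.isHermitian_mul_conjTranspose_self (coeffMatrix χ)).eigenvalues

/-- The Schmidt rank: the number of non-zero Schmidt coefficients. -/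
def schmidtRank {D : ℕ} (χ : BipState D) : ℕ :=
  Nat.card {r : Fin D // schmidtCoeff χ r ≠ 0}

/-- `χ` is a maximally entangled state of Schmidt rank `K`: it has exactly `K` non-zero Schmidt
coefficients, and each of them equals `1 / K`. -/
def IsMaxEntangledOfRank {D : ℕ} (K : ℕ) (χ : BipState D) : Prop :=
  schmidtRank χ = K ∧ ∀ r, schmidtCoeff χ r ≠ 0 → schmidtCoeff χ r = 1 / (K : ℝ)

/-- The operator `|χ⟩⟨χ|`. -/
def projector {ι : Type*} (χ : EuclideanSpace ℂ ι) : Matrix ι ι ℂ :=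
  Matrix.of fun i j => χ i * star (χ j)

/-- A separable operation on `ℂ^α ⊗ ℂ^β`, given by finitely many product Kraus operators
`A m ⊗ B m` that satisfy the closure condition. -/
structure SeparableOperation (α β : Type*) [Fintype α] [Fintype β] [DecidableEq α]
    [DecidableEq β] where
  M : ℕ
  A : Fin M → Matrix α α ℂ
  B : Fin M → Matrix β β ℂ
  closure : ∑ m, ((A m)ᴴ * A m) ⊗ₖ ((B m)ᴴ * B m) = 1

/-- The action `ρ ↦ ∑ m, (A m ⊗ B m) ρ (A m ⊗ B m)ᴴ` of a separable operation. -/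
def SeparableOperation.apply {α β : Type*} [Fintype α] [Fintype β] [DecidableEq α]
    [DecidableEq β] (Λ : SeparableOperation α β) (ρ : Matrix (α × β) (α × β) ℂ) :
    Matrix (α × β) (α × β) ℂ :=
  ∑ m, (Λ.A m ⊗ₖ Λ.B m) * ρ * (Λ.A m ⊗ₖ Λ.B m)ᴴ

/-- The state `|χ⟩^{AB} ⊗ |φ⟩^{ab}`, with the tensor factors arranged as `(A, a), (B, b)`:
the first pair of indices belongs to Alice, the second pair to Bob. -/
def jointState {D : ℕ} (χ φ : BipState D) :
    EuclideanSpace ℂ ((Fin D × Fin D) × (Fin D × Fin D)) :=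
  WithLp.toLp 2 fun p => χ (p.1.1, p.2.1) * φ (p.1.2, p.2.2)

/-- The family `ψ` can be locally cloned with the blank state `φ`: one separable operation with
respect to the cut `Aa / Bb` maps `|ψ i⟩ ⊗ |φ⟩` to `|ψ i⟩ ⊗ |ψ i⟩`, with probability one and up to
a phase, for every `i`. -/
def CanLocallyClone {D : ℕ} {I : Type*} (ψ : I → BipState D) (φ : BipState D) : Prop :=
  ∃ Λ : SeparableOperation (Fin D × Fin D) (Fin D × Fin D),
    ∀ i, Λ.apply (projector (jointState (ψ i) φ)) = projector (jointState (ψ i) (ψ i))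

/-- `ψ` is a family of group-shifted states of full Schmidt rank, labelled by the elements of a
finite group `G` (whose order is `D`, as `G` indexes bases of `ℂ^D`): for orthonormal bases `a` of
Alice's and `b` of Bob's space, positive `lam g` with sum `1` and real phases `θ f g`,
either `ψ f = ∑ g, √(lam g) e^{i θ f g} a g ⊗ b (f g)` for all `f`,
or `ψ f = ∑ g, √(lam g) e^{i θ f g} a (f g) ⊗ b g` for all `f`. -/
def IsGroupShifted {D : ℕ} {G : Type*} [Group G] [Fintype G] (ψ : G → BipState D) : Prop :=
  ∃ (a b : OrthonormalBasis G ℂ (EuclideanSpace ℂ (Fin D))) (lam : G → ℝ) (θ : G → G → ℝ),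
    (∀ g, 0 < lam g) ∧ ∑ g, lam g = 1 ∧
    ((∀ f, ψ f = ∑ g, ((Real.sqrt (lam g) : ℂ) * Complex.exp (Complex.I * (θ f g : ℂ))) •
        productState (a g) (b (f * g))) ∨
     (∀ f, ψ f = ∑ g, ((Real.sqrt (lam g) : ℂ) * Complex.exp (Complex.I * (θ f g : ℂ))) •
        productState (a (f * g)) (b g)))

/-- A maximally entangled state of Schmidt rank `D` is the minimum resource required for the local
cloning of `ψ` on a `D × D` system: every blank state that allows the cloning is a maximally
entangled state of Schmidt rank `D`, and as soon as some blank state allows the cloning, every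
maximally entangled state of Schmidt rank `D` does. -/
def MaxEntangledIsMinimumBlank {D : ℕ} {I : Type*} (ψ : I → BipState D) : Prop :=
  (∀ φ : BipState D, ‖φ‖ = 1 → CanLocallyClone ψ φ → IsMaxEntangledOfRank D φ) ∧
  ((∃ φ : BipState D, ‖φ‖ = 1 ∧ CanLocallyClone ψ φ) →
    ∀ φ : BipState D, IsMaxEntangledOfRank D φ → CanLocallyClone ψ φ)

end

/-! Write states as coefficient matrices: `N j` for the states to clone, `Φ` for the blank. Every
Kraus term of a deterministic pure output is proportional to that output, so cloning means `A m (N j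
⊗ Φ) (B m)ᵀ = c m j N j ⊗ N j` with `∑ m, |c m j|² = 1`.

The heart is the bound `‖Φ w‖² ≥ 1/D` for every unit vector `w`. Together with `tr Φᴴ Φ = 1` it
forces `Φᴴ Φ = 1/D`, that is, maximal entanglement. To get it, test the closure relation on `(e_x ⊗
Φ w) ⊗ (e_y ⊗ w̄)` and sum over `x, y`; the total is `D² ‖Φ w‖²`. It remains to show that each Kraus
operator contributes at least `|c m|² D`. Let `C` be the inverse of `(B m)ᵀ`, available when `c m ≠
0`. The cloning equation of a diagonal `N` expresses Alice's factor through `C (e_x ⊗ w)`, and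
Cauchy–Schwarz gives `‖B (e_x ⊗ w̄)‖² ‖C (e_x ⊗ w)‖² ≥ 1`. For a shifted family the moduli of `C
(e_x ⊗ w)` are, up to a shift, independent of `x`, and what is left is the correlation inequality `∑
x, lam (x+y) lam (x+z) / lam x ≥ 1`, proved for two and three coefficients. These steps are
`one_le_card_mul_normSum_mulVec`, `one_le_card_mul_normSum_of_shift` and
`conjTranspose_mul_self_eq_of_bound`.

A group of order three is cyclic, so qutrit families are shifted up to local unitaries. For qubits
this has to be derived: the relative matrix of the two states is traceless or scalar, by a
similarity argument, and orthonormality then leaves a shifted pair, a transposed shifted pair, or a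
maximally entangled first state.

Finally, maximally entangled blanks differ by a unitary on Alice's ancilla, so if one allows
cloning, all do. -/

noncomputable section

/-! ### Squared norms and product vectors -/

/-- The squared Euclidean norm of a complex vector. -/
def normSum {κ : Type*} [Fintype κ] (v : κ → ℂ) : ℝ := ∑ i, ‖v i‖ ^ 2

/-- The product vector of two complex vectors. -/
def tensorVec {α β : Type*} (p : α → ℂ) (q : β → ℂ) : α × β → ℂ := fun z => p z.1 * q z.2

theorem star_tensorVec {α β : Type*} (p : α → ℂ) (q : β → ℂ) :
    star (tensorVec p q) = tensorVec (star p) (star q) := by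
  ext z; simp [tensorVec]

theorem tensorVec_smul_left {α β : Type*} (c : ℂ) (p : α → ℂ) (q : β → ℂ) :
    tensorVec (c • p) q = c • tensorVec p q := by
  ext z; simp [tensorVec, mul_assoc]

section vectors

variable {α β κ : Type*} [Fintype α] [Fintype β] [Fintype κ]

theorem normSum_nonneg (v : κ → ℂ) : 0 ≤ normSum v := Finset.sum_nonneg fun _ _ => by positivity

theorem star_dotProduct_self_eq_normSum (v : κ → ℂ) : star v ⬝ᵥ v = (normSum v : ℂ) := by
  simp only [dotProduct, normSum, Pi.star_apply, Complex.ofReal_sum]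
  refine Finset.sum_congr rfl fun i _ => ?_
  rw [Complex.star_def, Complex.conj_mul']
  push_cast; rfl

theorem normSum_smul (c : ℂ) (v : κ → ℂ) : normSum (c • v) = ‖c‖ ^ 2 * normSum v := by
  simp [normSum, mul_pow, Finset.mul_sum]

theorem normSum_star (v : κ → ℂ) : normSum (star v) = normSum v := by
  simp [normSum]

theorem normSum_single [DecidableEq κ] (x : κ) : normSum (Pi.single x (1 : ℂ)) = 1 := by
  unfold normSum
  rw [Finset.sum_eq_single x]
  · simp
  · intro b _ hb; simp [hb]
  · simp

theorem normSum_tensorVec (p : α → ℂ) (q : β → ℂ) :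
    normSum (tensorVec p q) = normSum p * normSum q := by
  simp only [normSum, tensorVec, norm_mul, mul_pow, Fintype.sum_prod_type, Finset.sum_mul_sum]

theorem kronecker_mulVec_tensorVec {α' β' : Type*} (A : Matrix α' α ℂ) (B : Matrix β' β ℂ)
    (p : α → ℂ) (q : β → ℂ) :
    (A ⊗ₖ B) *ᵥ tensorVec p q = tensorVec (A *ᵥ p) (B *ᵥ q) := by
  ext ⟨i, j⟩
  simp only [Matrix.mulVec, dotProduct, tensorVec, Matrix.kroneckerMap_apply,
    Fintype.sum_prod_type, Finset.sum_mul_sum]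
  exact Finset.sum_congr rfl fun _ _ => Finset.sum_congr rfl fun _ _ => by ring

theorem star_dotProduct_conjTranspose_mul_mulVec {κ' : Type*} [Fintype κ'] (K : Matrix κ' κ ℂ)
    (v : κ → ℂ) : star v ⬝ᵥ (Kᴴ * K) *ᵥ v = (normSum (K *ᵥ v) : ℂ) := by
  rw [← star_dotProduct_self_eq_normSum, Matrix.star_mulVec, ← Matrix.mulVec_mulVec,
    Matrix.dotProduct_mulVec]

/-- The Cauchy–Schwarz inequality for `⟨v, u⟩` with `|⟨v, u⟩| = 1`. -/
theorem one_le_normSum_mul_normSum (u v : κ → ℂ) (h : star v ⬝ᵥ u = 1) :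
    1 ≤ normSum v * normSum u := by
  have h1 : (1 : ℝ) ≤ ∑ i, ‖v i‖ * ‖u i‖ := by
    calc (1 : ℝ) = ‖star v ⬝ᵥ u‖ := by rw [h]; simp
      _ ≤ ∑ i, ‖star v i * u i‖ := norm_sum_le _ _
      _ = _ := by simp
  have h2 := Finset.sum_mul_sq_le_sq_mul_sq Finset.univ (fun i => ‖v i‖) (fun i => ‖u i‖)
  unfold normSum
  nlinarith

end vectors

/-- The closure relation is used only through its quadratic form on product vectors, where each
Kraus term factorizes into an Alice norm and a Bob norm. -/
theorem sum_normSum_mul_normSum_of_closure {α β : Type*} [Fintype α] [Fintype β] [DecidableEq α]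
    [DecidableEq β] {M : ℕ} (A : Fin M → Matrix α α ℂ) (B : Fin M → Matrix β β ℂ)
    (hcl : ∑ m, ((A m)ᴴ * A m) ⊗ₖ ((B m)ᴴ * B m) = 1) (p : α → ℂ) (q : β → ℂ) :
    ∑ m, normSum (A m *ᵥ p) * normSum (B m *ᵥ q) = normSum p * normSum q := by
  have h : star (tensorVec p q) ⬝ᵥ (∑ m, ((A m)ᴴ * A m) ⊗ₖ ((B m)ᴴ * B m)) *ᵥ tensorVec p q
      = star (tensorVec p q) ⬝ᵥ tensorVec p q := by rw [hcl, Matrix.one_mulVec]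
  rw [star_dotProduct_self_eq_normSum, Matrix.sum_mulVec, dotProduct_sum] at h
  have h2 : ∀ m, star (tensorVec p q) ⬝ᵥ ((A m)ᴴ * A m) ⊗ₖ ((B m)ᴴ * B m) *ᵥ tensorVec p q
      = ((normSum (A m *ᵥ p) * normSum (B m *ᵥ q) : ℝ) : ℂ) := by
    intro m
    rw [Matrix.mul_kronecker_mul, ← Matrix.conjTranspose_kronecker,
      star_dotProduct_conjTranspose_mul_mulVec, kronecker_mulVec_tensorVec, normSum_tensorVec]
  simp only [h2] at h
  rw [← normSum_tensorVec]
  exact_mod_cast h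

/-! ### Cloning in matrix form -/

/-- The matrices `N j` are cloned by product Kraus operators with the blank matrix `Φ`
(map-state duality): `A (N ⊗ Φ) Bᵀ = c N ⊗ N` for each Kraus operator `A ⊗ B`. -/
def MatrixClonable {ι J : Type*} [Fintype ι] [DecidableEq ι] (N : J → Matrix ι ι ℂ)
    (Φ : Matrix ι ι ℂ) : Prop :=
  ∃ (M : ℕ) (A B : Fin M → Matrix (ι × ι) (ι × ι) ℂ) (c : Fin M → J → ℂ),
    ∑ m, ((A m)ᴴ * A m) ⊗ₖ ((B m)ᴴ * B m) = 1 ∧ (∀ j, ∑ m, ‖c m j‖ ^ 2 = 1) ∧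
    ∀ m j, A m * (N j ⊗ₖ Φ) * (B m)ᵀ = c m j • (N j ⊗ₖ N j)

section core

variable {ι : Type*} [Fintype ι] [DecidableEq ι]

theorem sum_kronecker_swap {α β : Type*} [Fintype α] [Fintype β] [DecidableEq α] [DecidableEq β]
    {M : ℕ} (X : Fin M → Matrix α α ℂ) (Y : Fin M → Matrix β β ℂ) (h : ∑ m, X m ⊗ₖ Y m = 1) :
    ∑ m, Y m ⊗ₖ X m = 1 := by
  ext ⟨i, j⟩ ⟨k, l⟩
  have := congrFun (congrFun h (j, i)) (l, k)
  simp only [Matrix.sum_apply, Matrix.kroneckerMap_apply] at this ⊢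
  simp only [mul_comm (Y _ _ _), this, Matrix.one_apply, Prod.mk.injEq, and_comm]

/-- Exchanging Alice and Bob transposes coefficient matrices. This reduces families shifted on
Alice's side to families shifted on Bob's side. -/
theorem MatrixClonable.transpose {J : Type*} {N : J → Matrix ι ι ℂ} {Φ : Matrix ι ι ℂ}
    (h : MatrixClonable N Φ) : MatrixClonable (fun j => (N j)ᵀ) Φᵀ := by
  obtain ⟨M, A, B, c, hcl, hc, heq⟩ := h
  refine ⟨M, B, A, c, sum_kronecker_swap _ _ hcl, hc, fun m j => ?_⟩
  have := congrArg Matrix.transpose (heq m j)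
  rw [Matrix.transpose_mul, Matrix.transpose_mul, Matrix.transpose_transpose,
    Matrix.transpose_smul, ← Matrix.kroneckerMap_transpose, ← Matrix.kroneckerMap_transpose] at this
  rw [← this, Matrix.mul_assoc]

/-- The cloning equation evaluated on `e x ⊗ w`, for a diagonal `N`. -/
theorem mul_normSum_mulVec_tensorVec_single (A R C : Matrix (ι × ι) (ι × ι) ℂ) (hRC : R * C = 1)
    (d : ι → ℂ) (lam : ι → ℝ) (hd : ∀ g, ‖d g‖ ^ 2 = lam g) (Φ : Matrix ι ι ℂ) (c : ℂ)
    (heq : A * (Matrix.diagonal d ⊗ₖ Φ) * R = c • (Matrix.diagonal d ⊗ₖ Matrix.diagonal d))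
    (w : ι → ℂ) (x : ι) :
    lam x * normSum (A *ᵥ tensorVec (Pi.single x 1) (Φ *ᵥ w)) =
      ‖c‖ ^ 2 * ∑ z : ι × ι, lam z.1 * lam z.2 *
        ‖(C *ᵥ tensorVec (Pi.single x 1) w) z‖ ^ 2 := by
  have h1 : A * (Matrix.diagonal d ⊗ₖ Φ) =
      c • ((Matrix.diagonal d ⊗ₖ Matrix.diagonal d) * C) := by
    rw [← Matrix.smul_mul, ← heq, Matrix.mul_assoc, hRC, Matrix.mul_one]
  have h2 := congrArg (fun X => normSum (X *ᵥ tensorVec (Pi.single x 1) w)) h1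
  simp only [← Matrix.mulVec_mulVec, kronecker_mulVec_tensorVec, Matrix.smul_mulVec,
    normSum_smul] at h2
  have h3 : Matrix.diagonal d *ᵥ Pi.single x 1 = d x • Pi.single x (1 : ℂ) := by
    ext i
    by_cases hi : i = x
    · subst hi; simp
    · simp [hi]
  rw [h3, tensorVec_smul_left, Matrix.mulVec_smul, normSum_smul, hd] at h2
  rw [h2]
  congr 1
  refine Finset.sum_congr rfl fun z _ => ?_
  rw [Matrix.diagonal_kronecker_diagonal, Matrix.mulVec_diagonal, norm_mul, norm_mul, mul_pow,
    mul_pow, hd, hd]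

/-- A lower bound on the blank, from a lower bound for each Kraus operator. -/
theorem one_le_card_mul_normSum_mulVec {M : ℕ} (A B C : Fin M → Matrix (ι × ι) (ι × ι) ℂ)
    (hcl : ∑ m, ((A m)ᴴ * A m) ⊗ₖ ((B m)ᴴ * B m) = 1) (c : Fin M → ℂ)
    (hc : ∑ m, ‖c m‖ ^ 2 = 1) (hC : ∀ m, c m ≠ 0 → (B m)ᵀ * C m = 1)
    (d : ι → ℂ) (lam : ι → ℝ) (hd : ∀ g, ‖d g‖ ^ 2 = lam g) (hlam : ∀ g, 0 < lam g)
    (Φ : Matrix ι ι ℂ)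
    (heq : ∀ m, A m * (Matrix.diagonal d ⊗ₖ Φ) * (B m)ᵀ =
      c m • (Matrix.diagonal d ⊗ₖ Matrix.diagonal d))
    (w : ι → ℂ) (hw : normSum w = 1)
    (hbound : ∀ m, c m ≠ 0 → (Fintype.card ι : ℝ) ≤
      (∑ x, (lam x)⁻¹ * ∑ z : ι × ι, lam z.1 * lam z.2 *
        ‖(C m *ᵥ tensorVec (Pi.single x 1) w) z‖ ^ 2) *
      ∑ x, normSum (B m *ᵥ tensorVec (Pi.single x 1) (star w))) [Nonempty ι] :
    1 ≤ Fintype.card ι * normSum (Φ *ᵥ w) := by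
  set n : ℝ := (Fintype.card ι : ℝ)
  have hn : 0 < n := by simp [n, Fintype.card_pos]
  have hterm : ∀ m, ‖c m‖ ^ 2 * n ≤
      (∑ x, normSum (A m *ᵥ tensorVec (Pi.single x 1) (Φ *ᵥ w))) *
      ∑ x, normSum (B m *ᵥ tensorVec (Pi.single x 1) (star w)) := by
    intro m
    by_cases hm : c m = 0
    · rw [hm]; simp only [norm_zero, ne_eq, OfNat.ofNat_ne_zero, not_false_eq_true, zero_pow,
        zero_mul]
      exact mul_nonneg (Finset.sum_nonneg fun _ _ => normSum_nonneg _)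
        (Finset.sum_nonneg fun _ _ => normSum_nonneg _)
    · have hx : ∑ x, normSum (A m *ᵥ tensorVec (Pi.single x 1) (Φ *ᵥ w)) =
          ‖c m‖ ^ 2 * ∑ x, (lam x)⁻¹ * ∑ z : ι × ι, lam z.1 * lam z.2 *
            ‖(C m *ᵥ tensorVec (Pi.single x 1) w) z‖ ^ 2 := by
        rw [Finset.mul_sum]
        refine Finset.sum_congr rfl fun x _ => ?_
        have := mul_normSum_mulVec_tensorVec_single (A m) _ (C m) (hC m hm) d lam hd Φ (c m)
          (heq m) w x
        rw [mul_left_comm, ← this, inv_mul_cancel_left₀ (hlam x).ne']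
      rw [hx, mul_assoc]
      exact mul_le_mul_of_nonneg_left (hbound m hm) (by positivity)
  -- Each of the `n²` test vectors `(e_x ⊗ Φ w) ⊗ (e_y ⊗ w̄)` has squared norm `‖Φ w‖²`.
  have htot : ∑ m, (∑ x, normSum (A m *ᵥ tensorVec (Pi.single x 1) (Φ *ᵥ w))) *
      ∑ x, normSum (B m *ᵥ tensorVec (Pi.single x 1) (star w)) = n * n * normSum (Φ *ᵥ w) := by
    simp only [Finset.sum_mul_sum]
    rw [Finset.sum_comm]
    have : ∀ x, ∑ m, ∑ y, normSum (A m *ᵥ tensorVec (Pi.single x 1) (Φ *ᵥ w)) *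
        normSum (B m *ᵥ tensorVec (Pi.single y 1) (star w)) = n * normSum (Φ *ᵥ w) := by
      intro x
      rw [Finset.sum_comm]
      simp only [sum_normSum_mul_normSum_of_closure A B hcl, normSum_tensorVec, normSum_single,
        normSum_star, hw]
      simp [n]
    simp only [this]
    simp [n, mul_assoc]
  have := Finset.sum_le_sum fun m (_ : m ∈ Finset.univ) => hterm m
  rw [htot, ← Finset.sum_mul, hc] at this
  nlinarith

/-! ### Invertibility of Bob's Kraus operators -/

theorem exists_rightInverse_of_cloning (A R : Matrix (ι × ι) (ι × ι) ℂ) (N Φ : Matrix ι ι ℂ)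
    (hN : N.det ≠ 0) (c : ℂ) (hc : c ≠ 0) (heq : A * (N ⊗ₖ Φ) * R = c • (N ⊗ₖ N)) :
    R * R⁻¹ = 1 := by
  refine Matrix.mul_nonsing_inv _ (isUnit_iff_ne_zero.mpr fun hR => ?_)
  have := congrArg Matrix.det heq
  rw [Matrix.det_mul, hR, mul_zero, Matrix.det_smul, Matrix.det_kronecker] at this
  simp [hc, hN] at this

/-- With `t = e_x ⊗ w`, the bilinear pairing of `B t̄` and `C t` equals `⟨t, Bᵀ C t⟩ = ‖t‖² = 1`;
apply Cauchy–Schwarz. -/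
theorem one_le_normSum_conjTranspose_inv (B C : Matrix (ι × ι) (ι × ι) ℂ) (hC : Bᵀ * C = 1)
    (w : ι → ℂ) (hw : normSum w = 1) (x : ι) :
    1 ≤ normSum (B *ᵥ tensorVec (Pi.single x 1) (star w)) *
      normSum (C *ᵥ tensorVec (Pi.single x 1) w) := by
  rw [← normSum_star (B *ᵥ _)]
  refine one_le_normSum_mul_normSum _ _ ?_
  have h : tensorVec (Pi.single x 1) (star w) = star (tensorVec (Pi.single x (1 : ℂ)) w) := by
    rw [star_tensorVec]
    congr 1
    ext i; by_cases hi : i = x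
    · subst hi; simp
    · simp [hi]
  rw [star_star, h, ← Matrix.vecMul_transpose, ← Matrix.dotProduct_mulVec, Matrix.mulVec_mulVec,
    hC, Matrix.one_mulVec, star_dotProduct_self_eq_normSum, normSum_tensorVec, normSum_single, hw]
  simp

end core

/-! ### Lower bound on the blank for shifted states -/

section shift

variable {ι : Type*} [Fintype ι] [DecidableEq ι] [AddCommGroup ι]

/-- The matrix `∑ g, d g |g⟩⟨f + g|`. -/
def shiftMatrix {ι : Type*} [DecidableEq ι] [AddCommGroup ι] (f : ι) (d : ι → ℂ) :
    Matrix ι ι ℂ :=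
  Matrix.of fun g h => if h = f + g then d g else 0

omit [Fintype ι] in
theorem shiftMatrix_zero (d : ι → ℂ) : shiftMatrix 0 d = Matrix.diagonal d := by
  ext g h
  simp only [shiftMatrix, Matrix.of_apply, zero_add, Matrix.diagonal_apply, eq_comm]

theorem shiftMatrix_mulVec_single (f g : ι) (d : ι → ℂ) :
    shiftMatrix f d *ᵥ Pi.single (f + g) 1 = d g • Pi.single g (1 : ℂ) := by
  ext i
  by_cases hi : i = g
  · subst hi; simp [shiftMatrix]
  · simp [shiftMatrix, hi, Ne.symm hi]

theorem shiftMatrix_kronecker_mulVec (f : ι) (d : ι → ℂ) (v : ι × ι → ℂ) (p q : ι) :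
    ((shiftMatrix f d ⊗ₖ shiftMatrix f d) *ᵥ v) (p, q) = d p * d q * v (f + p, f + q) := by
  simp only [Matrix.mulVec, dotProduct, Matrix.kroneckerMap_apply, shiftMatrix, Matrix.of_apply,
    Fintype.sum_prod_type]
  simp [ite_mul, mul_ite]

/-- A shift matrix times its adjoint is diagonal, so no permutation sign has to be computed. -/
theorem norm_det_shiftMatrix_sq (f : ι) (d : ι → ℂ) :
    ‖(shiftMatrix f d).det‖ ^ 2 = ∏ g, ‖d g‖ ^ 2 := by
  have h : shiftMatrix f d * (shiftMatrix f d)ᴴ = Matrix.diagonal fun g => d g * star (d g) := by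
    ext g h
    simp only [Matrix.mul_apply, shiftMatrix, Matrix.conjTranspose_apply, Matrix.of_apply,
      Matrix.diagonal_apply]
    by_cases hg : g = h
    · subst hg; simp
    · simp [hg]
  have h2 := congrArg (fun X => ‖X.det‖) h
  simp only [Matrix.det_mul, Matrix.det_conjTranspose, Matrix.det_diagonal, norm_mul, norm_star,
    norm_prod] at h2
  rw [sq, h2]
  simp only [sq]

/-- The shift by `f` sends `e_{f+g}` to a multiple of `e_g`. Hence the left side does not depend on
`f`, and comparing different `f` relates the columns of `C` to each other. -/
theorem lam_mul_norm_mulVec_shift (A R C : Matrix (ι × ι) (ι × ι) ℂ) (hRC : R * C = 1)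
    (f : ι) (d : ι → ℂ) (lam : ι → ℝ) (hd : ∀ g, ‖d g‖ ^ 2 = lam g) (Φ : Matrix ι ι ℂ) (c : ℂ)
    (heq : A * (shiftMatrix f d ⊗ₖ Φ) * R = c • (shiftMatrix f d ⊗ₖ shiftMatrix f d))
    (w : ι → ℂ) (g p q : ι) :
    lam g * ‖(A *ᵥ tensorVec (Pi.single g 1) (Φ *ᵥ w)) (p, q)‖ ^ 2 =
      ‖c‖ ^ 2 * (lam p * lam q *
        ‖(C *ᵥ tensorVec (Pi.single (f + g) 1) w) (f + p, f + q)‖ ^ 2) := by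
  have h1 : A * (shiftMatrix f d ⊗ₖ Φ) =
      c • ((shiftMatrix f d ⊗ₖ shiftMatrix f d) * C) := by
    rw [← Matrix.smul_mul, ← heq, Matrix.mul_assoc, hRC, Matrix.mul_one]
  have h2 := congrArg (fun X => ‖(X *ᵥ tensorVec (Pi.single (f + g) 1) w) (p, q)‖ ^ 2) h1
  simp only [← Matrix.mulVec_mulVec, kronecker_mulVec_tensorVec, Matrix.smul_mulVec,
    shiftMatrix_mulVec_single, tensorVec_smul_left, Matrix.mulVec_smul, Pi.smul_apply,
    shiftMatrix_kronecker_mulVec, smul_eq_mul, norm_mul, mul_pow, hd] at h2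
  exact h2

/-- All the shift matrices have determinants of the same modulus, so taking determinants in the
cloning equations leaves only `|c f|` to compare. -/
theorem norm_eq_of_cloning_shift (A R : Matrix (ι × ι) (ι × ι) ℂ) (d : ι → ι → ℂ) (lam : ι → ℝ)
    (hd : ∀ f g, ‖d f g‖ ^ 2 = lam g) (hlam : ∀ g, 0 < lam g) (Φ : Matrix ι ι ℂ) (c : ι → ℂ)
    (heq : ∀ f, A * (shiftMatrix f (d f) ⊗ₖ Φ) * R =
      c f • (shiftMatrix f (d f) ⊗ₖ shiftMatrix f (d f))) (f : ι) : ‖c f‖ = ‖c 0‖ := by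
  have hdet : ∀ f, ‖(shiftMatrix f (d f)).det‖ = ‖(shiftMatrix 0 (d 0)).det‖ := by
    intro f
    rw [← pow_left_inj₀ (norm_nonneg _) (norm_nonneg _) two_ne_zero, norm_det_shiftMatrix_sq,
      norm_det_shiftMatrix_sq]
    simp only [hd]
  have hne : ‖(shiftMatrix 0 (d 0)).det‖ ≠ 0 := by
    refine fun h => (Finset.prod_pos fun g (_ : g ∈ Finset.univ) => hlam g).ne' ?_
    simp only [← hd 0]
    rw [← norm_det_shiftMatrix_sq, h]; simp
  have key : ∀ f, ‖A.det‖ * (‖(shiftMatrix 0 (d 0)).det‖ ^ Fintype.card ι *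
      ‖Φ.det‖ ^ Fintype.card ι) * ‖R.det‖ = ‖c f‖ ^ Fintype.card (ι × ι) *
      (‖(shiftMatrix 0 (d 0)).det‖ ^ Fintype.card ι *
      ‖(shiftMatrix 0 (d 0)).det‖ ^ Fintype.card ι) := by
    intro f
    have h := congrArg (fun X => ‖X.det‖) (heq f)
    simpa only [Matrix.det_mul, Matrix.det_smul, Matrix.det_kronecker, norm_mul, norm_pow,
      hdet f] using h
  have h2 := (key f).symm.trans (key 0)
  have h3 := mul_right_cancel₀ (by positivity) h2
  exact (pow_left_inj₀ (norm_nonneg _) (norm_nonneg _) Fintype.card_ne_zero).mp h3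

/-- If the shifted matrices `∑ g, d f g |g⟩⟨f + g|` with `|d f g|² = lam g` are cloned with the
blank `Φ`, then `‖Φ w‖² ≥ 1 / D` for every unit vector `w`. -/
theorem one_le_card_mul_normSum_of_shift (d : ι → ι → ℂ) (lam : ι → ℝ)
    (hd : ∀ f g, ‖d f g‖ ^ 2 = lam g) (hlam : ∀ g, 0 < lam g)
    (hsum : ∀ y z, 1 ≤ ∑ x, (lam x)⁻¹ * (lam (x + y) * lam (x + z))) (Φ : Matrix ι ι ℂ)
    (h : MatrixClonable (fun f => shiftMatrix f (d f)) Φ) (w : ι → ℂ) (hw : normSum w = 1) :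
    1 ≤ Fintype.card ι * normSum (Φ *ᵥ w) := by
  obtain ⟨M, A, B, c, hcl, hc, heq⟩ := h
  have hdet : (shiftMatrix 0 (d 0)).det ≠ 0 := by
    intro h
    refine (Finset.prod_pos fun g (_ : g ∈ Finset.univ) => hlam g).ne' ?_
    simp only [← hd 0]
    rw [← norm_det_shiftMatrix_sq, h]; simp
  have hC : ∀ m, c m 0 ≠ 0 → (B m)ᵀ * ((B m)ᵀ)⁻¹ = 1 := fun m hm =>
    exists_rightInverse_of_cloning _ _ _ _ hdet _ hm (heq m 0)
  refine one_le_card_mul_normSum_mulVec A B (fun m => ((B m)ᵀ)⁻¹) hcl (fun m => c m 0) (hc 0) hC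
    (d 0) lam (hd 0) hlam Φ (fun m => ?_) w hw fun m hm => ?_
  · simpa only [shiftMatrix_zero] using heq m 0
  set C := ((B m)ᵀ)⁻¹
  set v := C *ᵥ tensorVec (Pi.single 0 1) w with hv
  -- Shift covariance: the equations for the states `x` and `0`, both taken at `g = 0`, have the
  -- same left side.
  have hnorm : ∀ x p q, ‖(C *ᵥ tensorVec (Pi.single x 1) w) (x + p, x + q)‖ ^ 2 =
      ‖v (p, q)‖ ^ 2 := by
    intro x p q
    have h1 := lam_mul_norm_mulVec_shift (A m) _ C (hC m hm) x (d x) lam (hd x) Φ _ (heq m x) w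
      0 p q
    have h0 := lam_mul_norm_mulVec_shift (A m) _ C (hC m hm) 0 (d 0) lam (hd 0) Φ _ (heq m 0) w
      0 p q
    rw [h1, norm_eq_of_cloning_shift (A m) (B m)ᵀ d lam hd hlam Φ (c m) (heq m) x] at h0
    have h2 := mul_left_cancel₀ (by positivity) h0
    have h3 := mul_left_cancel₀ (mul_pos (hlam p) (hlam q)).ne' h2
    simpa only [add_zero, zero_add] using h3
  have hreindex : ∀ (x : ι) (F : ι × ι → ℝ), ∑ z, F z = ∑ z : ι × ι, F (x + z.1, x + z.2) :=
    fun x F => (Equiv.sum_comp ((Equiv.addLeft x).prodCongr (Equiv.addLeft x)) F).symm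
  have hnv : ∀ x, normSum (C *ᵥ tensorVec (Pi.single x 1) w) = normSum v := by
    intro x
    unfold normSum
    rw [hreindex x]
    simp only [hnorm]
  -- After reindexing `z` by the shift `x`, the weight of `‖v z‖²` is exactly the correlation sum in
  -- `hsum`.
  have hA : normSum v ≤ ∑ x, (lam x)⁻¹ * ∑ z : ι × ι, lam z.1 * lam z.2 *
      ‖(C *ᵥ tensorVec (Pi.single x 1) w) z‖ ^ 2 := by
    have : ∑ x, (lam x)⁻¹ * ∑ z : ι × ι, lam z.1 * lam z.2 *
        ‖(C *ᵥ tensorVec (Pi.single x 1) w) z‖ ^ 2 =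
        ∑ z : ι × ι, (∑ x, (lam x)⁻¹ * (lam (x + z.1) * lam (x + z.2))) * ‖v z‖ ^ 2 := by
      simp only [Finset.sum_mul]
      rw [Finset.sum_comm]
      refine Finset.sum_congr rfl fun x _ => ?_
      rw [hreindex x, Finset.mul_sum]
      simp only [hnorm, mul_assoc]
    rw [this]
    exact Finset.sum_le_sum fun z _ => le_mul_of_one_le_left (by positivity) (hsum _ _)
  have hB : (Fintype.card ι : ℝ) ≤
      normSum v * ∑ x, normSum (B m *ᵥ tensorVec (Pi.single x 1) (star w)) := by
    rw [Finset.mul_sum]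
    calc (Fintype.card ι : ℝ) = ∑ _x : ι, (1 : ℝ) := by simp
      _ ≤ _ := Finset.sum_le_sum fun x _ => by
        rw [← hnv x, mul_comm]
        exact one_le_normSum_conjTranspose_inv (B m) C (hC m hm) w hw x
  exact hB.trans (mul_le_mul_of_nonneg_right hA
    (Finset.sum_nonneg fun _ _ => normSum_nonneg _))

omit [AddCommGroup ι] in
/-- The bound of `one_le_card_mul_normSum_of_shift` when one of the cloned matrices is diagonal with
entries of equal modulus `1 / √D`. -/
theorem one_le_card_mul_normSum_of_uniform [Nonempty ι] {J : Type*} (N : J → Matrix ι ι ℂ) (j : J)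
    (d : ι → ℂ) (hN : N j = Matrix.diagonal d) (hd : ∀ g, ‖d g‖ ^ 2 = (Fintype.card ι : ℝ)⁻¹)
    (Φ : Matrix ι ι ℂ) (h : MatrixClonable N Φ) (w : ι → ℂ) (hw : normSum w = 1) :
    1 ≤ Fintype.card ι * normSum (Φ *ᵥ w) := by
  obtain ⟨M, A, B, c, hcl, hc, heq⟩ := h
  have hn : (0 : ℝ) < Fintype.card ι := by simp [Fintype.card_pos]
  have hdet : (N j).det ≠ 0 := by
    rw [hN, Matrix.det_diagonal]
    refine Finset.prod_ne_zero_iff.mpr fun g _ h0 => ?_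
    have := hd g
    rw [h0, norm_zero, zero_pow two_ne_zero] at this
    exact (inv_pos.mpr hn).ne this
  have hC : ∀ m, c m j ≠ 0 → (B m)ᵀ * ((B m)ᵀ)⁻¹ = 1 := fun m hm =>
    exists_rightInverse_of_cloning _ _ _ _ hdet _ hm (heq m j)
  refine one_le_card_mul_normSum_mulVec A B (fun m => ((B m)ᵀ)⁻¹) hcl (fun m => c m j) (hc j) hC
    d _ hd (fun _ => by positivity) Φ (fun m => ?_) w hw fun m hm => ?_
  · simpa only [hN] using heq m j
  set C := ((B m)ᵀ)⁻¹
  set a : ι → ℝ := fun x => normSum (C *ᵥ tensorVec (Pi.single x 1) w) with ha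
  set b : ι → ℝ := fun x => normSum (B m *ᵥ tensorVec (Pi.single x 1) (star w)) with hb
  have ha0 : ∀ x, 0 ≤ a x := fun x => normSum_nonneg _
  have hb0 : ∀ x, 0 ≤ b x := fun x => normSum_nonneg _
  have hab : ∀ x, 1 ≤ b x * a x := fun x =>
    one_le_normSum_conjTranspose_inv (B m) C (hC m hm) w hw x
  -- With equal weights no covariance is needed: `∑ a · ∑ b ≥ (∑ √(a b))² ≥ D²` because each `a x *
  -- b x ≥ 1`.
  have hcs := Finset.sum_mul_sq_le_sq_mul_sq Finset.univ (fun x => √(a x)) (fun x => √(b x))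
  simp only [Real.sq_sqrt (ha0 _), Real.sq_sqrt (hb0 _)] at hcs
  have h1 : (Fintype.card ι : ℝ) ≤ ∑ x, √(a x) * √(b x) := by
    calc (Fintype.card ι : ℝ) = ∑ _x : ι, (1 : ℝ) := by simp
      _ ≤ _ := Finset.sum_le_sum fun x _ => by
        rw [← Real.sqrt_mul (ha0 x), mul_comm]
        exact Real.one_le_sqrt.mpr (hab x)
  have h2 : ∀ x, ((Fintype.card ι : ℝ)⁻¹)⁻¹ * ∑ z : ι × ι, (Fintype.card ι : ℝ)⁻¹ *
      (Fintype.card ι : ℝ)⁻¹ * ‖(C *ᵥ tensorVec (Pi.single x 1) w) z‖ ^ 2 =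
      (Fintype.card ι : ℝ)⁻¹ * a x := by
    intro x
    rw [← Finset.mul_sum, mul_assoc, inv_mul_cancel_left₀ (by positivity)]
    rfl
  rw [Finset.sum_congr rfl fun x _ => h2 x, ← Finset.mul_sum]
  rw [mul_assoc, le_inv_mul_iff₀ hn]
  refine le_trans ?_ hcs
  rw [sq]
  exact mul_self_le_mul_self hn.le h1

end shift

/-! ### The correlation inequality for two and three coefficients -/

theorem one_le_sum_inv_mul_mul_of_eq {ι : Type*} [Fintype ι] [AddCommGroup ι] (lam : ι → ℝ)
    (hlam : ∀ g, 0 < lam g) (h1 : ∑ g, lam g = 1) (y z : ι) (h : y = 0 ∨ z = 0 ∨ y = z) :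
    1 ≤ ∑ x, (lam x)⁻¹ * (lam (x + y) * lam (x + z)) := by
  have hshift : ∀ u, ∑ x, lam (x + u) = 1 := fun u => by
    rw [← h1]; exact Equiv.sum_comp (Equiv.addRight u) lam
  rcases h with rfl | rfl | rfl
  · rw [← hshift z]
    refine Finset.sum_le_sum fun x _ => ?_
    rw [add_zero, inv_mul_cancel_left₀ (hlam x).ne']
  · rw [← hshift y]
    refine Finset.sum_le_sum fun x _ => ?_
    rw [add_zero, mul_comm (lam (x + y)), inv_mul_cancel_left₀ (hlam x).ne']
  -- Termwise `b² / a ≥ 2 b - a`, and the right side sums to `2 - 1`.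
  · have : (1 : ℝ) = ∑ x, (2 * lam (x + y) - lam x) := by
      rw [Finset.sum_sub_distrib, ← Finset.mul_sum, hshift, h1]; norm_num
    rw [this]
    refine Finset.sum_le_sum fun x _ => ?_
    rw [le_inv_mul_iff₀ (hlam x)]
    nlinarith [sq_nonneg (lam (x + y) - lam x)]

theorem one_le_sum_inv_mul_mul_fin_two (lam : Fin 2 → ℝ) (hlam : ∀ g, 0 < lam g)
    (h1 : ∑ g, lam g = 1) (y z : Fin 2) :
    1 ≤ ∑ x, (lam x)⁻¹ * (lam (x + y) * lam (x + z)) :=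
  one_le_sum_inv_mul_mul_of_eq lam hlam h1 y z (by revert y z; decide)

theorem add_add_le_inv_mul_mul {a b c : ℝ} (ha : 0 < a) (hb : 0 < b) (hc : 0 < c) :
    a + b + c ≤ a⁻¹ * (b * c) + b⁻¹ * (c * a) + c⁻¹ * (a * b) := by
  have h : a⁻¹ * (b * c) + b⁻¹ * (c * a) + c⁻¹ * (a * b) - (a + b + c) =
      ((b * c - c * a) ^ 2 + (c * a - a * b) ^ 2 + (a * b - b * c) ^ 2) / (2 * a * b * c) := by
    field_simp
    ring
  have : 0 ≤ ((b * c - c * a) ^ 2 + (c * a - a * b) ^ 2 + (a * b - b * c) ^ 2) /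
      (2 * a * b * c) := by positivity
  linarith

theorem one_le_sum_inv_mul_mul_fin_three (lam : Fin 3 → ℝ) (hlam : ∀ g, 0 < lam g)
    (h1 : ∑ g, lam g = 1) (y z : Fin 3) :
    1 ≤ ∑ x, (lam x)⁻¹ * (lam (x + y) * lam (x + z)) := by
  have hyz : (y = 0 ∨ z = 0 ∨ y = z) ∨ (y = 1 ∧ z = 2) ∨ (y = 2 ∧ z = 1) := by
    revert y z; decide
  have key := add_add_le_inv_mul_mul (hlam 0) (hlam 1) (hlam 2)
  rw [Fin.sum_univ_three] at h1
  have e1 : (1 : Fin 3) + 1 = 2 := rfl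
  have e2 : (1 : Fin 3) + 2 = 0 := rfl
  have e3 : (2 : Fin 3) + 1 = 0 := rfl
  have e4 : (2 : Fin 3) + 2 = 1 := rfl
  rcases hyz with h | ⟨rfl, rfl⟩ | ⟨rfl, rfl⟩
  · exact one_le_sum_inv_mul_mul_of_eq lam hlam (by rw [Fin.sum_univ_three, h1]) y z h
  · rw [Fin.sum_univ_three]
    simp only [zero_add, e1, e2, e3, e4]
    linarith
  · rw [Fin.sum_univ_three]
    simp only [zero_add, e1, e2, e3, e4]
    linarith

/-! ### From states to matrices -/

theorem eq_zero_of_star_dotProduct_self {κ : Type*} [Fintype κ] {v : κ → ℂ}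
    (h : star v ⬝ᵥ v = 0) : v = 0 := by
  rw [star_dotProduct_self_eq_normSum, Complex.ofReal_eq_zero, normSum,
    Finset.sum_eq_zero_iff_of_nonneg fun _ _ => by positivity] at h
  ext i
  simpa using h i (Finset.mem_univ i)

/-- A rank-one positive operator is extremal: a vector orthogonal to `u` annihilates the quadratic
form of the sum, hence that of every summand. -/
theorem exists_smul_of_sum_vecMulVec {κ : Type*} [Fintype κ] {M : ℕ} (v : Fin M → κ → ℂ)
    (u : κ → ℂ) (hu : u ≠ 0)
    (h : ∑ m, Matrix.vecMulVec (v m) (star (v m)) = Matrix.vecMulVec u (star u)) :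
    ∃ c : Fin M → ℂ, (∀ m, v m = c m • u) ∧ ∑ m, ‖c m‖ ^ 2 = 1 := by
  have huu : star u ⬝ᵥ u ≠ 0 := fun h0 => hu (eq_zero_of_star_dotProduct_self h0)
  have hquad : ∀ r x : κ → ℂ, star r ⬝ᵥ Matrix.vecMulVec x (star x) *ᵥ r =
      ((‖star r ⬝ᵥ x‖ ^ 2 : ℝ) : ℂ) := by
    intro r x
    rw [Matrix.vecMulVec_mulVec, dotProduct_smul]
    have : star x ⬝ᵥ r = star (star r ⬝ᵥ x) := by
      rw [Matrix.star_dotProduct]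
    rw [this]
    simp only [MulOpposite.smul_eq_mul_unop, MulOpposite.unop_op]
    rw [Complex.star_def, Complex.mul_conj']
    push_cast; rfl
  set c : Fin M → ℂ := fun m => (star u ⬝ᵥ v m) / (star u ⬝ᵥ u) with hc
  have hv : ∀ m, v m = c m • u := by
    intro m
    -- The component of `v m` orthogonal to `u`; it is shown to be orthogonal to itself.
    set r := v m - c m • u with hr
    have hur : star u ⬝ᵥ r = 0 := by
      rw [hr, dotProduct_sub, dotProduct_smul, hc, smul_eq_mul, div_mul_cancel₀ _ huu, sub_self]
    have hru : star r ⬝ᵥ u = 0 := by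
      have := congrArg star hur
      rwa [Matrix.star_dotProduct, star_star, star_zero] at this
    have h2 := congrArg (fun X => star r ⬝ᵥ X *ᵥ r) h
    simp only [Matrix.sum_mulVec, dotProduct_sum, hquad, hru, norm_zero] at h2
    have h3 : ∑ m, ‖star r ⬝ᵥ v m‖ ^ 2 = 0 := by
      have h4 : ((∑ m, ‖star r ⬝ᵥ v m‖ ^ 2 : ℝ) : ℂ) = 0 := by
        rw [Complex.ofReal_sum, h2]; simp
      exact_mod_cast h4
    have h5 := (Finset.sum_eq_zero_iff_of_nonneg fun _ _ => by positivity).mp h3 m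
      (Finset.mem_univ m)
    have h6 : star r ⬝ᵥ v m = 0 := by simpa using h5
    have h7 : star r ⬝ᵥ r = 0 := by
      nth_rewrite 2 [hr]
      rw [dotProduct_sub, dotProduct_smul, h6, hru]; simp
    have h8 : r = 0 := eq_zero_of_star_dotProduct_self h7
    exact sub_eq_zero.mp h8
  refine ⟨c, hv, ?_⟩
  obtain ⟨i, hi⟩ := Function.ne_iff.mp hu
  have h9 := congrFun (congrFun h i) i
  simp only [Matrix.sum_apply, Matrix.vecMulVec_apply, Pi.star_apply, Complex.star_def,
    Complex.mul_conj'] at h9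
  have h10 : ∑ m, ‖v m i‖ ^ 2 = ‖u i‖ ^ 2 := by exact_mod_cast h9
  have hi' : (0 : ℝ) < ‖u i‖ ^ 2 := by
    have : 0 < ‖u i‖ := norm_pos_iff.mpr hi
    positivity
  have h11 : ∀ m, ‖v m i‖ ^ 2 = ‖c m‖ ^ 2 * ‖u i‖ ^ 2 := fun m => by
    rw [hv m, Pi.smul_apply, smul_eq_mul, norm_mul, mul_pow]
  simp only [h11, ← Finset.sum_mul] at h10
  exact mul_right_cancel₀ hi'.ne' (h10.trans (one_mul _).symm)

theorem projector_eq_vecMulVec {κ : Type*} (χ : EuclideanSpace ℂ κ) :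
    projector χ = Matrix.vecMulVec χ.ofLp (star χ.ofLp) := rfl

theorem mul_vecMulVec_mul_conjTranspose {κ κ' : Type*} [Fintype κ] (K : Matrix κ' κ ℂ)
    (v : κ → ℂ) :
    K * Matrix.vecMulVec v (star v) * Kᴴ = Matrix.vecMulVec (K *ᵥ v) (star (K *ᵥ v)) := by
  rw [Matrix.mul_vecMulVec, Matrix.vecMulVec_mul, Matrix.star_mulVec]

/-- Map-state duality. `Matrix.vec` stacks columns while the first index of a state is Alice's,
hence the transposes in the proof. -/
theorem kronecker_mulVec_jointState {D : ℕ} (A B : Matrix (Fin D × Fin D) (Fin D × Fin D) ℂ)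
    (χ φ : BipState D) (p : (Fin D × Fin D) × (Fin D × Fin D)) :
    ((A ⊗ₖ B) *ᵥ (jointState χ φ).ofLp) p =
      (A * (coeffMatrix χ ⊗ₖ coeffMatrix φ) * Bᵀ) p.1 p.2 := by
  have h : (jointState χ φ).ofLp =
      Matrix.vec (coeffMatrix χ ⊗ₖ coeffMatrix φ)ᵀ := by
    ext q; rfl
  rw [h, Matrix.kronecker_mulVec_vec]
  simp only [Matrix.vec]
  rw [← Matrix.transpose_apply (_ * _ * _)]
  simp only [Matrix.transpose_mul, Matrix.transpose_transpose, Matrix.mul_assoc]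

theorem coeffMatrix_ne_zero {D : ℕ} {χ : BipState D} (h : coeffMatrix χ ≠ 0) :
    (jointState χ χ).ofLp ≠ 0 := by
  intro h0
  apply h
  ext i j
  have : χ (i, j) * χ (i, j) = 0 := congrFun h0 ((i, i), (j, j))
  simpa [coeffMatrix] using this

theorem CanLocallyClone.matrixClonable {D : ℕ} {I : Type*} {ψ : I → BipState D} {φ : BipState D}
    (h : CanLocallyClone ψ φ) (hψ : ∀ i, coeffMatrix (ψ i) ≠ 0) :
    MatrixClonable (fun i => coeffMatrix (ψ i)) (coeffMatrix φ) := by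
  obtain ⟨Λ, hΛ⟩ := h
  have key : ∀ i, ∃ c : Fin Λ.M → ℂ, (∀ m, (Λ.A m ⊗ₖ Λ.B m) *ᵥ (jointState (ψ i) φ).ofLp =
      c m • (jointState (ψ i) (ψ i)).ofLp) ∧ ∑ m, ‖c m‖ ^ 2 = 1 := by
    intro i
    refine exists_smul_of_sum_vecMulVec _ _ (coeffMatrix_ne_zero (hψ i)) ?_
    have := hΛ i
    simp only [SeparableOperation.apply, projector_eq_vecMulVec,
      mul_vecMulVec_mul_conjTranspose] at this
    exact this
  choose c hc hc1 using key
  refine ⟨Λ.M, Λ.A, Λ.B, fun m i => c i m, Λ.closure, hc1, fun m i => ?_⟩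
  ext p q
  have := congrFun (hc i m) (p, q)
  rw [kronecker_mulVec_jointState] at this
  rw [this]; rfl

/-! ### Local unitaries -/

theorem closure_unitary_mul_mul {α : Type*} [Fintype α] [DecidableEq α] {M : ℕ}
    (A B : Fin M → Matrix α α ℂ) (hcl : ∑ m, ((A m)ᴴ * A m) ⊗ₖ ((B m)ᴴ * B m) = 1)
    (P Q P' Q' : Matrix α α ℂ) (hP : Pᴴ * P = 1) (hQ : Qᴴ * Q = 1) (hP' : P'ᴴ * P' = 1)
    (hQ' : Q'ᴴ * Q' = 1) :
    ∑ m, ((P * A m * Q)ᴴ * (P * A m * Q)) ⊗ₖ ((P' * B m * Q')ᴴ * (P' * B m * Q')) = 1 := by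
  have h : ∀ (P A Q : Matrix α α ℂ), Pᴴ * P = 1 →
      (P * A * Q)ᴴ * (P * A * Q) = Qᴴ * (Aᴴ * A) * Q := by
    intro P A Q hP
    calc (P * A * Q)ᴴ * (P * A * Q) = Qᴴ * Aᴴ * (Pᴴ * P) * A * Q := by
          simp only [Matrix.conjTranspose_mul, Matrix.mul_assoc]
      _ = _ := by rw [hP, Matrix.mul_one]; simp only [Matrix.mul_assoc]
  simp only [h _ _ _ hP, h _ _ _ hP', Matrix.mul_kronecker_mul] at hcl ⊢
  rw [← Finset.sum_mul, ← Finset.mul_sum, hcl, Matrix.mul_one, ← Matrix.mul_kronecker_mul, hQ, hQ',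
    Matrix.one_kronecker_one]

/-- A local change of basis is undone on the single input copy and redone on both output copies, so
the blank is untouched. -/
theorem MatrixClonable.of_unitary {ι J : Type*} [Fintype ι] [DecidableEq ι]
    {N N' : J → Matrix ι ι ℂ} {Φ : Matrix ι ι ℂ} (h : MatrixClonable N Φ) (U V : Matrix ι ι ℂ)
    (hU : Uᴴ * U = 1) (hV : Vᴴ * V = 1) (hN : ∀ j, N j = U * N' j * Vᵀ) :
    MatrixClonable N' Φ := by
  obtain ⟨M, A, B, c, hcl, hc, heq⟩ := h
  have hU' : U * Uᴴ = 1 := mul_eq_one_comm.mp hU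
  have hV' : V * Vᴴ = 1 := mul_eq_one_comm.mp hV
  have hVt : Vᵀ * Vᴴᵀ = 1 := by rw [← Matrix.transpose_mul, hV, Matrix.transpose_one]
  have hclosure : ∀ X : Matrix ι ι ℂ, Xᴴ * X = 1 → X * Xᴴ = 1 →
      (Xᴴ ⊗ₖ Xᴴ)ᴴ * (Xᴴ ⊗ₖ Xᴴ) = 1 ∧
      (X ⊗ₖ (1 : Matrix ι ι ℂ))ᴴ * (X ⊗ₖ (1 : Matrix ι ι ℂ)) = 1 := by
    intro X hX hX'
    rw [Matrix.conjTranspose_kronecker, Matrix.conjTranspose_kronecker,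
      ← Matrix.mul_kronecker_mul, ← Matrix.mul_kronecker_mul, Matrix.conjTranspose_conjTranspose,
      hX', Matrix.conjTranspose_one, Matrix.one_mul, hX, Matrix.one_kronecker_one]
    exact ⟨rfl, rfl⟩
  have hcl' := closure_unitary_mul_mul A B hcl (Uᴴ ⊗ₖ Uᴴ) (U ⊗ₖ (1 : Matrix ι ι ℂ)) (Vᴴ ⊗ₖ Vᴴ)
    (V ⊗ₖ (1 : Matrix ι ι ℂ)) (hclosure U hU hU').1 (hclosure U hU hU').2 (hclosure V hV hV').1
    (hclosure V hV hV').2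
  refine ⟨M, _, _, c, hcl', hc, fun m j => ?_⟩
  have hN2 : N' j = Uᴴ * N j * Vᴴᵀ := by
    rw [hN j]
    calc N' j = (Uᴴ * U) * N' j * (Vᵀ * Vᴴᵀ) := by rw [hU, hVt, Matrix.one_mul, Matrix.mul_one]
      _ = _ := by simp only [Matrix.mul_assoc]
  have htr : ((Vᴴ ⊗ₖ Vᴴ) * B m * (V ⊗ₖ (1 : Matrix ι ι ℂ)))ᵀ =
      (Vᵀ ⊗ₖ (1 : Matrix ι ι ℂ)) * (B m)ᵀ * (Vᴴᵀ ⊗ₖ Vᴴᵀ) := by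
    rw [Matrix.transpose_mul, Matrix.transpose_mul, ← Matrix.kroneckerMap_transpose,
      ← Matrix.kroneckerMap_transpose, Matrix.transpose_one, Matrix.mul_assoc]
  have hmid : (U ⊗ₖ (1 : Matrix ι ι ℂ)) * (N' j ⊗ₖ Φ) * (Vᵀ ⊗ₖ (1 : Matrix ι ι ℂ)) = N j ⊗ₖ Φ := by
    rw [← Matrix.mul_kronecker_mul, ← Matrix.mul_kronecker_mul, ← hN j, Matrix.one_mul,
      Matrix.mul_one]
  have hend : (Uᴴ ⊗ₖ Uᴴ) * (N j ⊗ₖ N j) * (Vᴴᵀ ⊗ₖ Vᴴᵀ) = N' j ⊗ₖ N' j := by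
    rw [← Matrix.mul_kronecker_mul, ← Matrix.mul_kronecker_mul, ← hN2]
  rw [htr, ← hend, ← Matrix.smul_mul, ← Matrix.mul_smul, ← heq, ← hmid]
  simp only [Matrix.mul_assoc]

/-! ### Maximally entangled states -/

theorem isMaxEntangledOfRank_iff {D : ℕ} (hD : 0 < D) (φ : BipState D) :
    IsMaxEntangledOfRank D φ ↔
      coeffMatrix φ * (coeffMatrix φ)ᴴ = ((D : ℂ)⁻¹) • (1 : Matrix (Fin D) (Fin D) ℂ) := by
  set H := Matrix.isHermitian_mul_conjTranspose_self (coeffMatrix φ)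
  have hD' : (D : ℝ) ≠ 0 := by positivity
  constructor
  · rintro ⟨hr, hval⟩
    -- A vanishing coefficient would leave fewer than `D` non-zero ones.
    have hall : ∀ r, schmidtCoeff φ r ≠ 0 := by
      intro r hr0
      have h1 : Nat.card {r : Fin D // schmidtCoeff φ r ≠ 0} < Fintype.card (Fin D) := by
        rw [Nat.card_eq_fintype_card]
        exact Fintype.card_subtype_lt (x := r) (by simpa using hr0)
      rw [Fintype.card_fin] at h1
      exact h1.ne hr
    have h1 : Complex.ofReal ∘ H.eigenvalues = fun _ => (D : ℂ)⁻¹ := by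
      ext r
      have : H.eigenvalues r = 1 / (D : ℝ) := hval r (hall r)
      simp [this]
    have h2 := H.spectral_theorem
    rw [h2]
    have h3 : Matrix.diagonal (RCLike.ofReal ∘ H.eigenvalues) =
        (D : ℂ)⁻¹ • (1 : Matrix (Fin D) (Fin D) ℂ) := by
      have : (RCLike.ofReal ∘ H.eigenvalues : Fin D → ℂ) = fun _ => (D : ℂ)⁻¹ := h1
      rw [this, Matrix.smul_one_eq_diagonal]
    rw [h3, map_smul, map_one]
  · intro h
    have hval : ∀ r, schmidtCoeff φ r = 1 / (D : ℝ) := by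
      intro r
      have h1 : (D : ℂ)⁻¹ • (H.eigenvectorBasis r).ofLp =
          H.eigenvalues r • (H.eigenvectorBasis r).ofLp := by
        rw [← H.mulVec_eigenvectorBasis r]
        nth_rewrite 2 [h]
        rw [Matrix.smul_mulVec, Matrix.one_mulVec]
      have hne : (H.eigenvectorBasis r).ofLp ≠ 0 := by
        intro h0
        have := H.eigenvectorBasis.orthonormal.ne_zero r
        exact this ((WithLp.ofLp_eq_zero 2).mp h0)
      obtain ⟨i, hi⟩ := Function.ne_iff.mp hne
      have h2 := congrFun h1 i
      simp only [Pi.smul_apply, smul_eq_mul, Complex.real_smul] at h2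
      have h3 := mul_right_cancel₀ hi h2
      have h4 : ((H.eigenvalues r : ℝ) : ℂ) = ((1 / D : ℝ) : ℂ) := by
        rw [← h3]; simp
      exact_mod_cast h4
    refine ⟨?_, fun r _ => hval r⟩
    have : ∀ r, schmidtCoeff φ r ≠ 0 := fun r => by rw [hval r]; positivity
    unfold schmidtRank
    simp [this]

theorem trace_conjTranspose_mul_coeffMatrix {D : ℕ} (φ : BipState D) :
    ((coeffMatrix φ)ᴴ * coeffMatrix φ).trace = ((‖φ‖ ^ 2 : ℝ) : ℂ) := by
  rw [EuclideanSpace.norm_sq_eq, Fintype.sum_prod_type, Finset.sum_comm]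
  simp only [Matrix.trace, Matrix.diag_apply, Matrix.mul_apply, Matrix.conjTranspose_apply,
    coeffMatrix, Matrix.of_apply, Complex.ofReal_sum]
  refine Finset.sum_congr rfl fun i _ => Finset.sum_congr rfl fun j _ => ?_
  rw [Complex.star_def, Complex.conj_mul']; push_cast; rfl

open scoped ComplexOrder in
/-- A matrix `Φ` with `tr (Φᴴ Φ) = 1` and `‖Φ w‖² ≥ 1 / n` on unit vectors satisfies
`Φᴴ Φ = 1 / n`. -/
theorem conjTranspose_mul_self_eq_of_bound {ι : Type*} [Fintype ι] [DecidableEq ι] [Nonempty ι]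
    (Φ : Matrix ι ι ℂ) (htr : (Φᴴ * Φ).trace = 1)
    (h : ∀ w, normSum w = 1 → 1 ≤ Fintype.card ι * normSum (Φ *ᵥ w)) :
    Φᴴ * Φ = (Fintype.card ι : ℂ)⁻¹ • (1 : Matrix ι ι ℂ) := by
  have hn : (0 : ℝ) < Fintype.card ι := by simp [Fintype.card_pos]
  have hnC : (Fintype.card ι : ℂ) ≠ 0 := by exact_mod_cast hn.ne'
  have hgen : ∀ w, normSum w ≤ Fintype.card ι * normSum (Φ *ᵥ w) := by
    intro w
    rcases (normSum_nonneg w).eq_or_lt with h0 | hpos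
    · rw [← h0]; exact mul_nonneg hn.le (normSum_nonneg _)
    · have hs : ‖(((√(normSum w))⁻¹ : ℝ) : ℂ)‖ ^ 2 = (normSum w)⁻¹ := by
        rw [Complex.norm_real, Real.norm_eq_abs, sq_abs, inv_pow, Real.sq_sqrt hpos.le]
      have := h ((((√(normSum w))⁻¹ : ℝ) : ℂ) • w) (by
        rw [normSum_smul, hs, inv_mul_cancel₀ hpos.ne'])
      rw [Matrix.mulVec_smul, normSum_smul, hs, mul_left_comm, le_inv_mul_iff₀ hpos,
        mul_one] at this
      exact this
  -- The bound makes this matrix positive semidefinite, and its trace is `n - n = 0`, so it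
  -- vanishes.
  have hpsd : ((Fintype.card ι : ℂ) • (Φᴴ * Φ) - 1).PosSemidef := by
    refine Matrix.PosSemidef.of_dotProduct_mulVec_nonneg ?_ fun w => ?_
    · refine Matrix.IsHermitian.sub ?_ Matrix.isHermitian_one
      rw [Matrix.IsHermitian, Matrix.conjTranspose_smul, Matrix.conjTranspose_mul,
        Matrix.conjTranspose_conjTranspose]
      simp
    · rw [Matrix.sub_mulVec, Matrix.smul_mulVec, Matrix.one_mulVec, dotProduct_sub,
        dotProduct_smul, star_dotProduct_conjTranspose_mul_mulVec,
        star_dotProduct_self_eq_normSum]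
      have := hgen w
      rw [smul_eq_mul, ← Complex.ofReal_natCast, ← Complex.ofReal_mul, ← Complex.ofReal_sub]
      exact Complex.zero_le_real.mpr (sub_nonneg.mpr this)
  have hz := (Matrix.PosSemidef.trace_eq_zero_iff hpsd).mp (by
    rw [Matrix.trace_sub, Matrix.trace_smul, htr, Matrix.trace_one]; simp)
  rw [sub_eq_zero] at hz
  rw [← hz, smul_smul, inv_mul_cancel₀ hnC, one_smul]

theorem isMaxEntangledOfRank_of_bound {D : ℕ} [NeZero D] (φ : BipState D) (hφ : ‖φ‖ = 1)
    (h : ∀ w, normSum w = 1 → 1 ≤ Fintype.card (Fin D) * normSum (coeffMatrix φ *ᵥ w)) :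
    IsMaxEntangledOfRank D φ := by
  have h1 := conjTranspose_mul_self_eq_of_bound (coeffMatrix φ)
    (by rw [trace_conjTranspose_mul_coeffMatrix, hφ]; simp) h
  rw [Fintype.card_fin] at h1
  have hD : (D : ℂ) ≠ 0 := by exact_mod_cast NeZero.ne D
  rw [isMaxEntangledOfRank_iff (NeZero.pos D)]
  have h2 : ((D : ℂ) • (coeffMatrix φ)ᴴ) * coeffMatrix φ = 1 := by
    rw [Matrix.smul_mul, h1, smul_smul, mul_inv_cancel₀ hD, one_smul]
  have h3 := mul_eq_one_comm.mp h2
  rw [Matrix.mul_smul] at h3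
  rw [← h3, smul_smul, inv_mul_cancel₀ hD, one_smul]

theorem isMaxEntangledOfRank_of_transpose_bound {D : ℕ} [NeZero D] (φ : BipState D) (hφ : ‖φ‖ = 1)
    (h : ∀ w, normSum w = 1 → 1 ≤ Fintype.card (Fin D) * normSum ((coeffMatrix φ)ᵀ *ᵥ w)) :
    IsMaxEntangledOfRank D φ := by
  have htr : (((coeffMatrix φ)ᵀ)ᴴ * (coeffMatrix φ)ᵀ).trace = 1 := by
    have := trace_conjTranspose_mul_coeffMatrix φ
    rw [hφ] at this
    rw [← Matrix.trace_transpose, Matrix.transpose_mul, Matrix.transpose_transpose,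
      Matrix.trace_mul_comm]
    exact this.trans (by simp)
  have h1 := conjTranspose_mul_self_eq_of_bound _ htr h
  rw [Fintype.card_fin] at h1
  rw [isMaxEntangledOfRank_iff (NeZero.pos D)]
  have h2 := congrArg Matrix.transpose h1
  rw [Matrix.transpose_mul, Matrix.transpose_transpose, Matrix.transpose_smul,
    Matrix.transpose_one] at h2
  exact h2

/-- All maximally entangled blanks of full Schmidt rank are equally powerful. -/
theorem CanLocallyClone.of_isMaxEntangledOfRank {D : ℕ} [NeZero D] {I : Type*}
    {ψ : I → BipState D} {φ₀ φ : BipState D} (h : CanLocallyClone ψ φ₀)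
    (h0 : IsMaxEntangledOfRank D φ₀) (h1 : IsMaxEntangledOfRank D φ) : CanLocallyClone ψ φ := by
  obtain ⟨Λ, hΛ⟩ := h
  have hD : (D : ℂ) ≠ 0 := by exact_mod_cast NeZero.ne D
  rw [isMaxEntangledOfRank_iff (NeZero.pos D)] at h0 h1
  -- The unitary on Alice's ancilla carrying `φ` to `φ₀`; Alice applies it before the known
  -- protocol.
  set W := (D : ℂ) • (coeffMatrix φ₀ * (coeffMatrix φ)ᴴ) with hW
  have hinv : ∀ X : Matrix (Fin D) (Fin D) ℂ, X * Xᴴ = (D : ℂ)⁻¹ • 1 →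
      (D : ℂ) • (Xᴴ * X) = 1 := by
    intro X hX
    have : X * ((D : ℂ) • Xᴴ) = 1 := by
      rw [Matrix.mul_smul, hX, smul_smul, mul_inv_cancel₀ hD, one_smul]
    rw [← Matrix.smul_mul]
    exact mul_eq_one_comm.mp this
  have hWφ : W * coeffMatrix φ = coeffMatrix φ₀ := by
    rw [hW, Matrix.smul_mul, Matrix.mul_assoc, ← Matrix.mul_smul, hinv _ h1, Matrix.mul_one]
  have hWW : W * Wᴴ = 1 := by
    nth_rewrite 2 [hW]
    rw [Matrix.conjTranspose_smul, Matrix.conjTranspose_mul, Matrix.conjTranspose_conjTranspose,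
      Matrix.mul_smul, ← Matrix.mul_assoc, hWφ, h0, smul_smul]
    simp [hD]
  have hWW' : Wᴴ * W = 1 := mul_eq_one_comm.mp hWW
  refine ⟨⟨Λ.M, fun m => Λ.A m * (1 ⊗ₖ W), Λ.B, ?_⟩, fun i => ?_⟩
  · have := closure_unitary_mul_mul Λ.A Λ.B Λ.closure 1 (1 ⊗ₖ W) 1 1 (by simp)
      (by simp [Matrix.conjTranspose_kronecker, ← Matrix.mul_kronecker_mul, hWW']) (by simp)
      (by simp)
    simpa using this
  · rw [← hΛ i]
    simp only [SeparableOperation.apply, projector_eq_vecMulVec, mul_vecMulVec_mul_conjTranspose]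
    refine Finset.sum_congr rfl fun m _ => ?_
    have : ((Λ.A m * (1 ⊗ₖ W)) ⊗ₖ Λ.B m) *ᵥ (jointState (ψ i) φ).ofLp =
        (Λ.A m ⊗ₖ Λ.B m) *ᵥ (jointState (ψ i) φ₀).ofLp := by
      ext p
      rw [kronecker_mulVec_jointState, kronecker_mulVec_jointState, Matrix.mul_assoc (Λ.A m),
        ← Matrix.mul_kronecker_mul, Matrix.one_mul, hWφ]
    rw [this]

theorem maxEntangledIsMinimumBlank_of_necessary {D : ℕ} [NeZero D] {I : Type*}
    (ψ : I → BipState D)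
    (h : ∀ φ : BipState D, ‖φ‖ = 1 → CanLocallyClone ψ φ → IsMaxEntangledOfRank D φ) :
    MaxEntangledIsMinimumBlank ψ :=
  ⟨h, fun ⟨φ₀, hφ₀, hcl⟩ _ hφ => hcl.of_isMaxEntangledOfRank (h φ₀ hφ₀ hcl) hφ⟩

/-! ### Group-shifted two-qutrit states -/

theorem MatrixClonable.comp {ι J J' : Type*} [Fintype ι] [DecidableEq ι] {N : J → Matrix ι ι ℂ}
    {Φ : Matrix ι ι ℂ} (h : MatrixClonable N Φ) (e : J' → J) :
    MatrixClonable (fun j => N (e j)) Φ := by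
  obtain ⟨M, A, B, c, hcl, hc, heq⟩ := h
  exact ⟨M, A, B, fun m j => c m (e j), hcl, fun j => hc _, fun m j => heq m _⟩

theorem conjTranspose_mul_self_of_orthonormalBasis {D : ℕ} {G : Type*} [Fintype G]
    (a : OrthonormalBasis G ℂ (EuclideanSpace ℂ (Fin D))) (e : Fin D ≃ G) :
    (Matrix.of fun i x => a (e x) i)ᴴ * (Matrix.of fun i x => a (e x) i) =
      (1 : Matrix (Fin D) (Fin D) ℂ) := by
  classical
  ext x y
  have := orthonormal_iff_ite.mp a.orthonormal (e x) (e y)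
  rw [PiLp.inner_apply] at this
  simp only [Matrix.mul_apply, Matrix.conjTranspose_apply, Matrix.of_apply, Matrix.one_apply]
  simp only [EmbeddingLike.apply_eq_iff_eq] at this
  rw [← this]
  refine Finset.sum_congr rfl fun i _ => ?_
  simp [mul_comm]

theorem mul_shiftMatrix_mul_transpose_apply {D : ℕ} [NeZero D] (U V : Matrix (Fin D) (Fin D) ℂ)
    (f : Fin D) (d : Fin D → ℂ) (i j : Fin D) :
    (U * shiftMatrix f d * Vᵀ) i j = ∑ x, d x * (U i x * V j (f + x)) := by
  simp only [Matrix.mul_apply, Matrix.transpose_apply, shiftMatrix, Matrix.of_apply,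
    Finset.sum_mul]
  rw [Finset.sum_comm]
  refine Finset.sum_congr rfl fun x _ => ?_
  rw [Finset.sum_eq_single (f + x)]
  · simp only [if_true]; ring
  · intro y _ hy; simp [hy]
  · simp

theorem mul_shiftMatrix_mul_transpose_ne_zero {D : ℕ} [NeZero D] (U V : Matrix (Fin D) (Fin D) ℂ)
    (hU : Uᴴ * U = 1) (hV : Vᴴ * V = 1) (f : Fin D) (d : Fin D → ℂ) (hd : d 0 ≠ 0) :
    U * shiftMatrix f d * Vᵀ ≠ 0 := by
  intro h
  have hVt : Vᵀ * Vᴴᵀ = 1 := by rw [← Matrix.transpose_mul, hV, Matrix.transpose_one]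
  have h2 : shiftMatrix f d = Uᴴ * (U * shiftMatrix f d * Vᵀ) * Vᴴᵀ := by
    calc shiftMatrix f d = (Uᴴ * U) * shiftMatrix f d * (Vᵀ * Vᴴᵀ) := by
          rw [hU, hVt, Matrix.one_mul, Matrix.mul_one]
      _ = _ := by simp only [Matrix.mul_assoc]
  rw [h, Matrix.mul_zero, Matrix.zero_mul] at h2
  have := congrFun (congrFun h2 0) (f + 0)
  simp only [shiftMatrix, Matrix.of_apply, if_true, Matrix.zero_apply] at this
  exact hd this

theorem coeffMatrix_sum_smul_productState {D : ℕ} {G : Type*} [Fintype G] (e : Fin D ≃ G)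
    (s : G → ℂ) (x y : G → EuclideanSpace ℂ (Fin D)) (i j : Fin D) :
    coeffMatrix (∑ g, s g • productState (x g) (y g)) i j =
      ∑ k, s (e k) * (x (e k) i * y (e k) j) := by
  rw [Equiv.sum_comp e fun g => s g * (x g i * y g j)]
  simp [coeffMatrix, productState]

theorem norm_sqrt_mul_exp_sq {r : ℝ} (hr : 0 < r) (t : ℝ) :
    ‖((Real.sqrt r : ℂ) * Complex.exp (Complex.I * (t : ℂ)))‖ ^ 2 = r := by
  rw [norm_mul, mul_comm Complex.I, Complex.norm_exp_ofReal_mul_I, mul_one, Complex.norm_real,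
    Real.norm_eq_abs, sq_abs, Real.sq_sqrt hr.le]

theorem isMaxEntangledOfRank_of_isGroupShifted {G : Type*} [Group G] [Fintype G]
    (ψ : G → BipState 3) (hψ : IsGroupShifted ψ) (φ : BipState 3) (hφ : ‖φ‖ = 1)
    (hcl : CanLocallyClone ψ φ) : IsMaxEntangledOfRank 3 φ := by
  obtain ⟨a, b, lam, θ, hlam, hsum, hform⟩ := hψ
  have hcard : Nat.card G = 3 := by
    rw [Nat.card_eq_fintype_card, ← Module.finrank_eq_card_basis a.toBasis, finrank_euclideanSpace,
      Fintype.card_fin]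
  have : Fact (Nat.Prime 3) := ⟨Nat.prime_three⟩
  -- Prime order makes `G` cyclic, so left multiplication becomes addition in `Fin 3`, which is
  -- `ZMod 3` by definition.
  let e' : Multiplicative (ZMod 3) ≃* G := mulEquivOfPrimeCardEq (p := 3) (by simp) hcard
  let e : Fin 3 ≃ G := e'.toEquiv
  have he : ∀ f x : Fin 3, e (f + x) = e f * e x := fun f x =>
    MulEquiv.map_mul e' (Multiplicative.ofAdd (α := ZMod 3) f) (Multiplicative.ofAdd (α := ZMod 3) x)
  set U : Matrix (Fin 3) (Fin 3) ℂ := Matrix.of fun i x => a (e x) i with hUdef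
  set V : Matrix (Fin 3) (Fin 3) ℂ := Matrix.of fun i x => b (e x) i with hVdef
  have hU : Uᴴ * U = 1 := conjTranspose_mul_self_of_orthonormalBasis a e
  have hV : Vᴴ * V = 1 := conjTranspose_mul_self_of_orthonormalBasis b e
  set d : Fin 3 → Fin 3 → ℂ := fun f x =>
    (Real.sqrt (lam (e x)) : ℂ) * Complex.exp (Complex.I * (θ (e f) (e x) : ℂ)) with hddef
  have hd : ∀ f g, ‖d f g‖ ^ 2 = lam (e g) := fun f g => norm_sqrt_mul_exp_sq (hlam _) _
  have hd0 : ∀ f, d f 0 ≠ 0 := by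
    intro f h0
    have h1 := hd f 0
    rw [h0, norm_zero, zero_pow two_ne_zero] at h1
    exact (hlam (e 0)).ne h1
  have hsum' : ∑ g, lam (e g) = 1 := by rw [← hsum]; exact Equiv.sum_comp e lam
  have hineq := one_le_sum_inv_mul_mul_fin_three (fun g => lam (e g)) (fun g => hlam _) hsum'
  rcases hform with hform | hform
  · have hN : ∀ f, coeffMatrix (ψ (e f)) = U * shiftMatrix f (d f) * Vᵀ := by
      intro f
      ext i j
      rw [hform, coeffMatrix_sum_smul_productState e, mul_shiftMatrix_mul_transpose_apply]
      simp only [hUdef, hVdef, Matrix.of_apply, he, hddef]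
    have hne : ∀ g, coeffMatrix (ψ g) ≠ 0 := by
      intro g
      rw [← e.apply_symm_apply g, hN]
      exact mul_shiftMatrix_mul_transpose_ne_zero U V hU hV _ _ (hd0 _)
    refine isMaxEntangledOfRank_of_bound φ hφ ?_
    exact one_le_card_mul_normSum_of_shift d _ hd (fun _ => hlam _) hineq _
      (((hcl.matrixClonable hne).comp e).of_unitary U V hU hV hN)
  · have hN : ∀ f, (coeffMatrix (ψ (e f)))ᵀ = V * shiftMatrix f (d f) * Uᵀ := by
      intro f
      ext i j
      rw [Matrix.transpose_apply, hform, coeffMatrix_sum_smul_productState e,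
        mul_shiftMatrix_mul_transpose_apply]
      simp only [hUdef, hVdef, Matrix.of_apply, he, hddef, mul_comm (a _ _)]
    have hne : ∀ g, coeffMatrix (ψ g) ≠ 0 := by
      intro g h0
      rw [← e.apply_symm_apply g] at h0
      refine mul_shiftMatrix_mul_transpose_ne_zero V U hV hU (e.symm g) _ (hd0 (e.symm g)) ?_
      rw [← hN, h0, Matrix.transpose_zero]
    refine isMaxEntangledOfRank_of_transpose_bound φ hφ ?_
    exact one_le_card_mul_normSum_of_shift d _ hd (fun _ => hlam _) hineq _
      (((hcl.matrixClonable hne).transpose.comp e).of_unitary V U hV hU hN)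

/-! ### Two-qubit states -/

theorem det_coeffMatrix_ne_zero_of_isEntangled {χ : BipState 2} (h : IsEntangled χ) :
    (coeffMatrix χ).det ≠ 0 := by
  intro hdet
  apply h
  rw [Matrix.det_fin_two] at hdet
  simp only [coeffMatrix, Matrix.of_apply] at hdet
  have hbuild : ∀ x y : Fin 2 → ℂ, (∀ i j, χ (i, j) = x i * y j) →
      ∃ x y : EuclideanSpace ℂ (Fin 2), χ = productState x y := by
    intro x y hxy
    refine ⟨WithLp.toLp 2 x, WithLp.toLp 2 y, ?_⟩
    ext ⟨i, j⟩
    exact hxy i j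
  by_cases ha : χ (0, 0) = 0
  · by_cases hb : χ (0, 1) = 0
    · refine hbuild ![0, 1] ![χ (1, 0), χ (1, 1)] ?_
      simp [Fin.forall_fin_two, ha, hb]
    · have hc : χ (1, 0) = 0 := by
        rw [ha, zero_mul, zero_sub, neg_eq_zero] at hdet
        exact (mul_eq_zero.mp hdet).resolve_left hb
      refine hbuild ![1, χ (1, 1) / χ (0, 1)] ![0, χ (0, 1)] ?_
      simp [Fin.forall_fin_two, ha, hc, div_mul_cancel₀ _ hb]
  · refine hbuild ![1, χ (1, 0) / χ (0, 0)] ![χ (0, 0), χ (0, 1)] ?_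
    have : χ (1, 1) = χ (1, 0) / χ (0, 0) * χ (0, 1) := by
      field_simp
      linear_combination hdet
    simp [Fin.forall_fin_two, div_mul_cancel₀ _ ha, this]

open scoped ComplexOrder in
/-- The singular value decomposition of an invertible matrix. -/
theorem exists_unitary_diagonal_unitary {ι : Type*} [Fintype ι] [DecidableEq ι]
    (X : Matrix ι ι ℂ) (hX : X.det ≠ 0) :
    ∃ (U V : Matrix ι ι ℂ) (s : ι → ℝ), Uᴴ * U = 1 ∧ Vᴴ * V = 1 ∧ (∀ i, 0 < s i) ∧
      X = U * Matrix.diagonal (fun i => (s i : ℂ)) * Vᵀ := by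
  have hpd : (X * Xᴴ).PosDef := by
    refine Matrix.PosDef.mul_conjTranspose_self X ?_
    exact Matrix.vecMul_injective_of_isUnit
      ((Matrix.isUnit_iff_isUnit_det X).mpr (isUnit_iff_ne_zero.mpr hX))
  set H := hpd.isHermitian
  set U : Matrix ι ι ℂ := (H.eigenvectorUnitary : Matrix ι ι ℂ) with hUdef
  have hU : Uᴴ * U = 1 := Unitary.coe_star_mul_self H.eigenvectorUnitary
  have hU' : U * Uᴴ = 1 := mul_eq_one_comm.mp hU
  set s : ι → ℝ := fun i => √(H.eigenvalues i)
  have hs : ∀ i, 0 < s i := fun i => Real.sqrt_pos.mpr (hpd.eigenvalues_pos i)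
  have hsC : ∀ i, (s i : ℂ) ≠ 0 := fun i => by exact_mod_cast (hs i).ne'
  have hspec : X * Xᴴ = U * Matrix.diagonal (fun i => (s i : ℂ) * (s i : ℂ)) * Uᴴ := by
    have h := H.spectral_theorem
    rw [Unitary.conjStarAlgAut_apply] at h
    have h2 : (RCLike.ofReal ∘ H.eigenvalues : ι → ℂ) = fun i => (s i : ℂ) * (s i : ℂ) := by
      ext i
      rw [← Complex.ofReal_mul, Real.mul_self_sqrt (hpd.eigenvalues_pos i).le]
      rfl
    rw [h2] at h
    exact h
  -- The right unitary factor of the decomposition; its transpose is the witness `V`.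
  set Y := Matrix.diagonal (fun i => (s i : ℂ)⁻¹) * Uᴴ * X with hY
  have hYY : Y * Yᴴ = 1 := by
    have : Y * Yᴴ = Matrix.diagonal (fun i => (s i : ℂ)⁻¹) * Uᴴ * (X * Xᴴ) * U *
        (Matrix.diagonal (fun i => (s i : ℂ)⁻¹))ᴴ := by
      rw [hY]
      simp only [Matrix.conjTranspose_mul, Matrix.conjTranspose_conjTranspose, Matrix.mul_assoc]
    rw [this, hspec, Matrix.diagonal_conjTranspose]
    calc _ = Matrix.diagonal (fun i => (s i : ℂ)⁻¹) * (Uᴴ * U) *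
          Matrix.diagonal (fun i => (s i : ℂ) * (s i : ℂ)) * (Uᴴ * U) *
          Matrix.diagonal (star fun i => (s i : ℂ)⁻¹) := by simp only [Matrix.mul_assoc]
      _ = 1 := by
        rw [hU, Matrix.mul_one, Matrix.mul_one, Matrix.diagonal_mul_diagonal,
          Matrix.diagonal_mul_diagonal, ← Matrix.diagonal_one]
        congr 1
        ext i
        have := hsC i
        simp [this]
  refine ⟨U, Yᵀ, s, hU, ?_, hs, ?_⟩
  · have := congrArg Matrix.transpose hYY
    rw [Matrix.transpose_mul, Matrix.transpose_one] at this
    exact this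
  · rw [Matrix.transpose_transpose, hY]
    calc X = (U * Uᴴ) * X := by rw [hU', Matrix.one_mul]
      _ = U * (Matrix.diagonal (fun i => (s i : ℂ)) *
          Matrix.diagonal (fun i => (s i : ℂ)⁻¹)) * Uᴴ * X := by
        rw [Matrix.diagonal_mul_diagonal]
        simp [hsC]
      _ = _ := by simp only [Matrix.mul_assoc]

/-! ### Similarity constraint on the relative matrix of two cloned states -/

theorem trace_eq_trace_of_mul_eq_mul {κ : Type*} [Fintype κ] [DecidableEq κ]
    {C K L : Matrix κ κ ℂ} (hC : C.det ≠ 0) (h : C * K = L * C) : K.trace = L.trace := by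
  have hu : IsUnit C.det := isUnit_iff_ne_zero.mpr hC
  calc K.trace = (C⁻¹ * (C * K)).trace := by rw [Matrix.nonsing_inv_mul_cancel_left _ _ hu]
    _ = (C⁻¹ * (L * C)).trace := by rw [h]
    _ = L.trace := by
      rw [← Matrix.mul_assoc, Matrix.trace_mul_comm, ← Matrix.mul_assoc, Matrix.mul_nonsing_inv _ hu,
        Matrix.one_mul]

/-- If `T ⊗ 1` is similar to `T ⊗ T` for an invertible `2 × 2` matrix `T`, then `T` is traceless or
the identity. -/
theorem trace_eq_zero_or_eq_one_of_similar (T : Matrix (Fin 2) (Fin 2) ℂ)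
    (C : Matrix (Fin 2 × Fin 2) (Fin 2 × Fin 2) ℂ) (hC : C.det ≠ 0) (hT : T.det ≠ 0)
    (h : C * (T ⊗ₖ (1 : Matrix (Fin 2) (Fin 2) ℂ)) = (T ⊗ₖ T) * C) : T.trace = 0 ∨ T = 1 := by
  have h2 : C * ((T * T) ⊗ₖ (1 : Matrix (Fin 2) (Fin 2) ℂ)) = ((T * T) ⊗ₖ (T * T)) * C := by
    have e1 : (T * T) ⊗ₖ (1 : Matrix (Fin 2) (Fin 2) ℂ) = (T ⊗ₖ 1) * (T ⊗ₖ 1) := by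
      rw [← Matrix.mul_kronecker_mul, Matrix.one_mul]
    rw [e1, Matrix.mul_kronecker_mul, ← Matrix.mul_assoc, h, Matrix.mul_assoc, h, Matrix.mul_assoc]
  have t1 := trace_eq_trace_of_mul_eq_mul hC h
  have t2 := trace_eq_trace_of_mul_eq_mul hC h2
  rw [Matrix.trace_kronecker, Matrix.trace_kronecker, Matrix.trace_one, Fintype.card_fin] at t1 t2
  by_cases h0 : T.trace = 0
  · exact Or.inl h0
  right
  have ht : T.trace = 2 := (mul_left_cancel₀ h0 t1).symm.trans (by norm_num)
  have hdet2 : T.det ^ 2 = 1 := by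
    have h3 := congrArg Matrix.det h
    rw [Matrix.det_mul, Matrix.det_mul, Matrix.det_kronecker, Matrix.det_kronecker, mul_comm] at h3
    have h4 := mul_right_cancel₀ hC h3
    simp only [Matrix.det_one, one_pow, mul_one, Fintype.card_fin] at h4
    exact mul_left_cancel₀ (pow_ne_zero 2 hT) (by rw [mul_one]; exact h4.symm)
  have htr2 : (T * T).trace = T.trace ^ 2 - 2 * T.det := by
    simp [Matrix.trace_fin_two, Matrix.det_fin_two, Matrix.mul_apply, Fin.sum_univ_two]
    ring
  -- From `det² = 1`, the value `-1` is excluded: it would give `tr T² = 6`, but `2 tr T² = (tr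
  -- T²)²`.
  have hdet : T.det = 1 := by
    rw [htr2, ht] at t2
    push_cast at t2
    linear_combination t2 / 12 + hdet2 / 3
  have hTT : T * T = (2 : ℂ) • T - 1 := by
    rw [Matrix.trace_fin_two] at ht
    rw [Matrix.det_fin_two] at hdet
    ext i j
    fin_cases i <;> fin_cases j <;>
      simp [Matrix.mul_apply, Fin.sum_univ_two]
    · linear_combination T 0 0 * ht - hdet
    · linear_combination T 0 1 * ht
    · linear_combination T 1 0 * ht
    · linear_combination T 1 1 * ht - hdet
  -- Similarity carries the relation `X² = 2 X - 1` from `T ⊗ 1` to `T ⊗ T`.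
  have hL : (T * T) ⊗ₖ (T * T) = (2 : ℂ) • (T ⊗ₖ T) - 1 := by
    have h3 : (T * T) ⊗ₖ (1 : Matrix (Fin 2) (Fin 2) ℂ) = (2 : ℂ) • (T ⊗ₖ 1) - 1 := by
      rw [hTT, sub_eq_add_neg, Matrix.add_kronecker, Matrix.smul_kronecker, ← neg_one_smul ℂ,
        Matrix.smul_kronecker, Matrix.one_kronecker_one, neg_one_smul, ← sub_eq_add_neg]
    rw [h3, mul_sub, Matrix.mul_smul, h, Matrix.mul_one] at h2
    have h4 : ((2 : ℂ) • (T ⊗ₖ T) - 1) * C = ((T * T) ⊗ₖ (T * T)) * C := by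
      rw [← h2, sub_mul, Matrix.one_mul, Matrix.smul_mul]
    have hu : IsUnit C.det := isUnit_iff_ne_zero.mpr hC
    have h5 := congrArg (fun X => X * C⁻¹) h4
    simp only [Matrix.mul_nonsing_inv_cancel_right _ _ hu] at h5
    exact h5.symm
  ext i j
  -- With `t = T i j` this entry reads `(2 t - δ)² = 2 t² - δ`, that is, `(t - 1)² = 0` on the
  -- diagonal and `t² = 0` off it.
  have h5 := congrFun (congrFun hL (i, i)) (j, j)
  rw [hTT] at h5
  simp only [Matrix.kroneckerMap_apply, Matrix.sub_apply, Matrix.smul_apply, smul_eq_mul,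
    Matrix.one_apply, Prod.mk.injEq, and_self] at h5 ⊢
  split_ifs at h5 ⊢
  · exact sub_eq_zero.mp (pow_eq_zero_iff two_ne_zero |>.mp (by linear_combination h5 / 2))
  · exact pow_eq_zero_iff two_ne_zero |>.mp (by linear_combination h5 / 2)

/-- Determinants show that `|c m j|² |det (N j)|` does not depend on `j`. Summing over `m` removes
the probabilities. -/
theorem norm_det_eq_of_matrixClonable {J : Type*} (N : J → Matrix (Fin 2) (Fin 2) ℂ)
    (Φ : Matrix (Fin 2) (Fin 2) ℂ) (hdet : ∀ j, (N j).det ≠ 0) (h : MatrixClonable N Φ) (j k : J) :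
    ‖(N j).det‖ = ‖(N k).det‖ := by
  obtain ⟨M, A, B, c, -, hc, heq⟩ := h
  have key : ∀ m j, ‖(A m).det‖ * ‖Φ.det‖ ^ 2 * ‖(B m)ᵀ.det‖ = (‖c m j‖ ^ 2 * ‖(N j).det‖) ^ 2 := by
    intro m j
    have h1 := congrArg (fun X => ‖X.det‖) (heq m j)
    simp only [Matrix.det_mul, Matrix.det_smul, Matrix.det_kronecker, norm_mul, norm_pow,
      Fintype.card_prod, Fintype.card_fin] at h1
    have h2 : ‖(N j).det‖ ^ 2 ≠ 0 := pow_ne_zero _ (norm_ne_zero_iff.mpr (hdet j))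
    refine mul_right_cancel₀ h2 ?_
    linear_combination h1
  have hm : ∀ m, ‖c m j‖ ^ 2 * ‖(N j).det‖ = ‖c m k‖ ^ 2 * ‖(N k).det‖ := fun m =>
    (pow_left_inj₀ (by positivity) (by positivity) two_ne_zero).mp
      ((key m j).symm.trans (key m k))
  have hs := Finset.sum_congr rfl fun m (_ : m ∈ Finset.univ) => hm m
  rwa [← Finset.sum_mul, ← Finset.sum_mul, hc, hc, one_mul, one_mul] at hs

/-- The relative matrix `S` of two cloned invertible matrices `N j` and `N k = N j * S` is traceless
or scalar. -/
theorem trace_eq_zero_or_eq_smul_of_matrixClonable {J : Type*} (N : J → Matrix (Fin 2) (Fin 2) ℂ)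
    (Φ : Matrix (Fin 2) (Fin 2) ℂ) (hdet : ∀ j, (N j).det ≠ 0) (h : MatrixClonable N Φ) (j k : J)
    (S : Matrix (Fin 2) (Fin 2) ℂ) (hS : N k = N j * S) :
    S.trace = 0 ∨ ∃ z : ℂ, N k = z • N j := by
  obtain ⟨M, A, B, c, -, hc, heq⟩ := h
  obtain ⟨m, hm⟩ : ∃ m, c m k ≠ 0 := by
    by_contra! h0
    have := hc k
    simp [h0] at this
  set R := (B m)ᵀ with hR
  have hRC : R * R⁻¹ = 1 := exists_rightInverse_of_cloning _ _ _ _ (hdet k) _ hm (heq m k)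
  set C := R⁻¹ with hCdef
  have hCdet : C.det ≠ 0 := by
    intro h0
    have := congrArg Matrix.det hRC
    rw [Matrix.det_mul, h0, mul_zero, Matrix.det_one] at this
    exact zero_ne_one this
  have hSdet : S.det ≠ 0 := by
    intro h0
    apply hdet k
    rw [hS, Matrix.det_mul, h0, mul_zero]
  have hj : A m * (N j ⊗ₖ Φ) = (N j ⊗ₖ N j) * (c m j • C) := by
    rw [Matrix.mul_smul, ← Matrix.smul_mul, ← heq m j, Matrix.mul_assoc, hRC, Matrix.mul_one]
  have hk : A m * (N k ⊗ₖ Φ) = (N j ⊗ₖ N j) * (c m k • ((S ⊗ₖ S) * C)) := by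
    have : (N j ⊗ₖ N j) * (c m k • ((S ⊗ₖ S) * C)) = (c m k • (N k ⊗ₖ N k)) * C := by
      rw [hS, Matrix.mul_kronecker_mul, Matrix.mul_smul, Matrix.smul_mul, Matrix.mul_assoc]
    rw [this, ← heq m k, Matrix.mul_assoc, hRC, Matrix.mul_one]
  have hjk : N k ⊗ₖ Φ = (N j ⊗ₖ Φ) * (S ⊗ₖ (1 : Matrix (Fin 2) (Fin 2) ℂ)) := by
    rw [← Matrix.mul_kronecker_mul, ← hS, Matrix.mul_one]
  rw [hjk, ← Matrix.mul_assoc, hj, Matrix.mul_assoc] at hk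
  have hu : IsUnit (N j ⊗ₖ N j).det := by
    rw [Matrix.det_kronecker]
    exact isUnit_iff_ne_zero.mpr (mul_ne_zero (pow_ne_zero _ (hdet j)) (pow_ne_zero _ (hdet j)))
  have hrel : c m j • (C * (S ⊗ₖ (1 : Matrix (Fin 2) (Fin 2) ℂ))) = c m k • ((S ⊗ₖ S) * C) := by
    rw [← Matrix.smul_mul, ← Matrix.nonsing_inv_mul_cancel_left _ (_ * _) hu, hk,
      Matrix.nonsing_inv_mul_cancel_left _ _ hu]
  have hcj : c m j ≠ 0 := by
    intro h0
    rw [h0, zero_smul] at hrel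
    have h1 := congrArg Matrix.det hrel.symm
    rw [Matrix.det_smul, Matrix.det_mul, Matrix.det_kronecker, Matrix.det_zero] at h1
    simp [hm, hSdet, hCdet] at h1
  -- Rescaling `S` by `ω` absorbs the scalar and gives an exact similarity of `T ⊗ 1` and `T ⊗ T`.
  set ω := (c m j)⁻¹ * c m k with hω
  have hω0 : ω ≠ 0 := mul_ne_zero (inv_ne_zero hcj) hm
  have hrel2 : C * (S ⊗ₖ (1 : Matrix (Fin 2) (Fin 2) ℂ)) = ω • ((S ⊗ₖ S) * C) := by
    rw [hω, mul_smul, ← hrel, smul_smul, inv_mul_cancel₀ hcj, one_smul]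
  rcases trace_eq_zero_or_eq_one_of_similar (ω • S) C hCdet
    (by rw [Matrix.det_smul]; exact mul_ne_zero (pow_ne_zero _ hω0) hSdet)
    (by rw [Matrix.smul_kronecker, Matrix.smul_kronecker, Matrix.kronecker_smul, Matrix.mul_smul,
          hrel2, Matrix.smul_mul, Matrix.smul_mul]) with h0 | h1
  · left
    rw [Matrix.trace_smul] at h0
    exact (smul_eq_zero.mp h0).resolve_left hω0
  · refine Or.inr ⟨ω⁻¹, ?_⟩
    have : S = ω⁻¹ • (1 : Matrix (Fin 2) (Fin 2) ℂ) := by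
      rw [← h1, smul_smul, inv_mul_cancel₀ hω0, one_smul]
    rw [hS, this, Matrix.mul_smul, Matrix.mul_one]

theorem inner_eq_trace_coeffMatrix {D : ℕ} (χ φ : BipState D) :
    inner ℂ χ φ = ((coeffMatrix χ)ᴴ * coeffMatrix φ).trace := by
  rw [PiLp.inner_apply, Fintype.sum_prod_type, Finset.sum_comm]
  simp only [Matrix.trace, Matrix.diag_apply, Matrix.mul_apply, Matrix.conjTranspose_apply,
    coeffMatrix, Matrix.of_apply]
  refine Finset.sum_congr rfl fun i _ => Finset.sum_congr rfl fun j _ => ?_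
  simp [mul_comm]

theorem trace_conjTranspose_mul_of_unitary {ι : Type*} [Fintype ι] [DecidableEq ι]
    (U V X Y : Matrix ι ι ℂ) (hU : Uᴴ * U = 1) (hV : Vᴴ * V = 1) :
    ((U * X * Vᵀ)ᴴ * (U * Y * Vᵀ)).trace = (Xᴴ * Y).trace := by
  have hVt : Vᵀ * (Vᵀ)ᴴ = 1 := by
    have := congrArg Matrix.transpose hV
    rw [Matrix.transpose_mul, Matrix.transpose_one] at this
    exact this
  have : (U * X * Vᵀ)ᴴ * (U * Y * Vᵀ) = (Vᵀ)ᴴ * (Xᴴ * (Uᴴ * U) * Y * Vᵀ) := by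
    simp only [Matrix.conjTranspose_mul, Matrix.mul_assoc]
  rw [this, hU, Matrix.mul_one, Matrix.trace_mul_comm, Matrix.mul_assoc, Matrix.mul_assoc, hVt,
    Matrix.mul_one]

/-- The possible forms of the second of two orthonormal cloned matrices, the first being
diagonal. -/
theorem two_qubit_normal_form (N : Fin 2 → Matrix (Fin 2) (Fin 2) ℂ) (Φ : Matrix (Fin 2) (Fin 2) ℂ)
    (s : Fin 2 → ℝ) (hs : ∀ i, 0 < s i) (hN0 : N 0 = Matrix.diagonal fun i => (s i : ℂ))
    (hdet : ∀ j, (N j).det ≠ 0) (h00 : ((N 0)ᴴ * N 0).trace = 1) (h01 : ((N 0)ᴴ * N 1).trace = 0)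
    (h11 : ((N 1)ᴴ * N 1).trace = 1) (h : MatrixClonable N Φ) :
    s 0 ^ 2 + s 1 ^ 2 = 1 ∧ (s 0 ^ 2 = s 1 ^ 2 ∨
      (N 1 0 0 = 0 ∧ N 1 1 1 = 0 ∧
        ((‖N 1 0 1‖ ^ 2 = s 0 ^ 2 ∧ ‖N 1 1 0‖ ^ 2 = s 1 ^ 2) ∨
         (‖N 1 1 0‖ ^ 2 = s 0 ^ 2 ∧ ‖N 1 0 1‖ ^ 2 = s 1 ^ 2)))) := by
  have hsC : ∀ i, (s i : ℂ) ≠ 0 := fun i => by exact_mod_cast (hs i).ne'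
  have e00 : s 0 ^ 2 + s 1 ^ 2 = 1 := by
    rw [hN0, Matrix.diagonal_conjTranspose, Matrix.diagonal_mul_diagonal, Matrix.trace_diagonal,
      Fin.sum_univ_two] at h00
    simp only [Pi.star_apply, Complex.star_def, Complex.conj_ofReal] at h00
    rw [sq, sq]
    exact_mod_cast h00
  refine ⟨e00, ?_⟩
  have e01 : (s 0 : ℂ) * N 1 0 0 + s 1 * N 1 1 1 = 0 := by
    rw [hN0, Matrix.diagonal_conjTranspose, Matrix.trace_fin_two] at h01
    simpa [Matrix.diagonal_mul] using h01
  set S := Matrix.diagonal (fun i => (s i : ℂ)⁻¹) * N 1 with hSdef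
  have hS : N 1 = N 0 * S := by
    rw [hSdef, hN0, ← Matrix.mul_assoc, Matrix.diagonal_mul_diagonal]
    simp [hsC]
  have htr : (s 0 : ℂ)⁻¹ * N 1 0 0 + (s 1 : ℂ)⁻¹ * N 1 1 1 = 0 := by
    rcases trace_eq_zero_or_eq_smul_of_matrixClonable N Φ hdet h 0 1 S hS with h0 | ⟨z, hz⟩
    · rw [hSdef, Matrix.trace_fin_two] at h0
      simpa [Matrix.diagonal_mul] using h0
    -- A scalar multiple of `N 0` that is orthogonal to `N 0` would be zero.
    · exfalso
      rw [hz, Matrix.mul_smul, Matrix.trace_smul, h00, smul_eq_mul, mul_one] at h01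
      apply hdet 1
      rw [hz, h01, zero_smul, Matrix.det_zero]
  by_cases heq : s 0 ^ 2 = s 1 ^ 2
  · exact Or.inl heq
  right
  have hne : (s 0 : ℂ) ^ 2 - (s 1 : ℂ) ^ 2 ≠ 0 := by
    rw [sub_ne_zero]; exact_mod_cast heq
  -- Orthogonality and tracelessness are two linear equations in the diagonal entries, independent
  -- when `s 0 ≠ s 1`.
  have hz0 : N 1 0 0 = 0 := by
    have h0 := hsC 0
    have h1 := hsC 1
    field_simp at htr
    refine (mul_eq_zero.mp (?_ : ((s 0 : ℂ) ^ 2 - (s 1 : ℂ) ^ 2) * N 1 0 0 = 0)).resolve_left hne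
    linear_combination (s 0 : ℂ) * e01 - (s 1 : ℂ) * htr
  have hz1 : N 1 1 1 = 0 := by
    rw [hz0, mul_zero, zero_add] at e01
    exact (mul_eq_zero.mp e01).resolve_left (hsC 1)
  refine ⟨hz0, hz1, ?_⟩
  have e11 : ‖N 1 0 1‖ ^ 2 + ‖N 1 1 0‖ ^ 2 = 1 := by
    rw [Matrix.trace_fin_two] at h11
    simp only [Matrix.mul_apply, Fin.sum_univ_two, Matrix.conjTranspose_apply, hz0, hz1,
      Complex.star_def, Complex.conj_mul', norm_zero] at h11
    have h12 : (0 ^ 2 + ‖N 1 1 0‖ ^ 2 + (‖N 1 0 1‖ ^ 2 + 0 ^ 2) : ℝ) = 1 := by exact_mod_cast h11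
    linarith
  have hd : ‖N 1 0 1‖ * ‖N 1 1 0‖ = s 0 * s 1 := by
    have h1 := norm_det_eq_of_matrixClonable N Φ hdet h 1 0
    rw [Matrix.det_fin_two, hz0, hN0, Matrix.det_diagonal, Fin.prod_univ_two] at h1
    simpa [abs_of_pos (hs _)] using h1
  -- The squared off-diagonal moduli have the same sum and product as `s 0 ^ 2` and `s 1 ^ 2`, so
  -- they are the same pair.
  have hprod : (‖N 1 0 1‖ ^ 2 - s 0 ^ 2) * (‖N 1 0 1‖ ^ 2 - s 1 ^ 2) = 0 := by
    linear_combination ‖N 1 0 1‖ ^ 2 * (e11 - e00) -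
      (‖N 1 0 1‖ * ‖N 1 1 0‖ + s 0 * s 1) * hd
  rcases mul_eq_zero.mp hprod with h1 | h1
  · exact Or.inl ⟨by linarith, by linarith⟩
  · exact Or.inr ⟨by linarith, by linarith⟩

theorem isMaxEntangledOfRank_of_two_qubit (ψ : Fin 2 → BipState 2) (hψ : Orthonormal ℂ ψ)
    (hent : ∀ i, IsEntangled (ψ i)) (φ : BipState 2) (hφ : ‖φ‖ = 1)
    (hcl : CanLocallyClone ψ φ) : IsMaxEntangledOfRank 2 φ := by
  have hMdet : ∀ i, (coeffMatrix (ψ i)).det ≠ 0 := fun i =>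
    det_coeffMatrix_ne_zero_of_isEntangled (hent i)
  obtain ⟨U, V, s, hU, hV, hs, hM0⟩ := exists_unitary_diagonal_unitary _ (hMdet 0)
  have hU' : U * Uᴴ = 1 := mul_eq_one_comm.mp hU
  have hVt : (Vᴴ)ᵀ * Vᵀ = 1 := by
    rw [← Matrix.transpose_mul, mul_eq_one_comm.mp hV, Matrix.transpose_one]
  have hVt' : Vᵀ * (Vᴴ)ᵀ = 1 := mul_eq_one_comm.mp hVt
  set N : Fin 2 → Matrix (Fin 2) (Fin 2) ℂ := fun i => Uᴴ * coeffMatrix (ψ i) * (Vᴴ)ᵀ with hNdef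
  have hN : ∀ i, coeffMatrix (ψ i) = U * N i * Vᵀ := by
    intro i
    calc coeffMatrix (ψ i) = (U * Uᴴ) * coeffMatrix (ψ i) * ((Vᴴ)ᵀ * Vᵀ) := by
          rw [hU', hVt, Matrix.one_mul, Matrix.mul_one]
      _ = _ := by simp only [hNdef, Matrix.mul_assoc]
  have hN0 : N 0 = Matrix.diagonal fun i => (s i : ℂ) := by
    calc N 0 = (Uᴴ * U) * Matrix.diagonal (fun i => (s i : ℂ)) * (Vᵀ * (Vᴴ)ᵀ) := by
          simp only [hNdef]; rw [hM0]; simp only [Matrix.mul_assoc]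
      _ = _ := by rw [hU, hVt', Matrix.one_mul, Matrix.mul_one]
  have hdet : ∀ i, (N i).det ≠ 0 := by
    intro i h0
    apply hMdet i
    rw [hN i, Matrix.det_mul, Matrix.det_mul, h0, mul_zero, zero_mul]
  have htr : ∀ i j, ((N i)ᴴ * N j).trace = if i = j then 1 else 0 := by
    intro i j
    rw [← trace_conjTranspose_mul_of_unitary U V _ _ hU hV, ← hN, ← hN,
      ← inner_eq_trace_coeffMatrix]
    exact orthonormal_iff_ite.mp hψ i j
  have hcl' : MatrixClonable N (coeffMatrix φ) :=
    (hcl.matrixClonable fun i h0 => hMdet i (by rw [h0, Matrix.det_zero])).of_unitary U V hU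
      hV hN
  have hnorm : ∀ g, ‖(s g : ℂ)‖ ^ 2 = s g ^ 2 := fun g => by
    rw [Complex.norm_real, Real.norm_eq_abs, sq_abs]
  have hpos : ∀ g, 0 < s g ^ 2 := fun g => by have := hs g; positivity
  obtain ⟨hsum, hcase⟩ := two_qubit_normal_form N (coeffMatrix φ) s hs hN0 hdet (htr 0 0) (htr 0 1)
    (htr 1 1) hcl'
  rcases hcase with heq | ⟨hz0, hz1, hcase⟩
  -- If the first state is maximally entangled, it alone gives the bound. Otherwise the pair is
  -- shifted, or its transpose is.
  · refine isMaxEntangledOfRank_of_bound φ hφ ?_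
    refine one_le_card_mul_normSum_of_uniform N 0 _ hN0 (fun g => ?_) _ hcl'
    rw [hnorm, Fintype.card_fin]
    fin_cases g <;> simp <;> linarith
  have hineq := one_le_sum_inv_mul_mul_fin_two (fun g => s g ^ 2) hpos
    (by rw [Fin.sum_univ_two, hsum])
  rcases hcase with ⟨ha, hb⟩ | ⟨ha, hb⟩
  · refine isMaxEntangledOfRank_of_bound φ hφ ?_
    set d : Fin 2 → Fin 2 → ℂ := ![fun g => (s g : ℂ), ![N 1 0 1, N 1 1 0]] with hd
    have hshift : N = fun f => shiftMatrix f (d f) := by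
      ext f i j
      fin_cases f
      · simp [hd, shiftMatrix_zero, hN0]
      · fin_cases i <;> fin_cases j <;> simp [hd, shiftMatrix, hz0, hz1]
    rw [hshift] at hcl'
    refine one_le_card_mul_normSum_of_shift d _ ?_ hpos hineq _ hcl'
    simp [Fin.forall_fin_two, hd, ha, hb]
  · refine isMaxEntangledOfRank_of_transpose_bound φ hφ ?_
    set d : Fin 2 → Fin 2 → ℂ := ![fun g => (s g : ℂ), ![N 1 1 0, N 1 0 1]] with hd
    have hshift : (fun f => (N f)ᵀ) = fun f => shiftMatrix f (d f) := by
      ext f i j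
      fin_cases f
      · simp [hd, shiftMatrix_zero, hN0]
        exact congrFun (congrFun (Matrix.diagonal_transpose fun k => (s k : ℂ)) i) j
      · fin_cases i <;> fin_cases j <;> simp [hd, shiftMatrix, hz0, hz1]
    have hcl'' := hcl'.transpose
    rw [hshift] at hcl''
    refine one_le_card_mul_normSum_of_shift d _ ?_ hpos hineq _ hcl''
    simp [Fin.forall_fin_two, hd, ha, hb]

end

theorem mainTheorem8 :
    (∀ ψ : Fin 2 → BipState 2, Orthonormal ℂ ψ → (∀ i, IsEntangled (ψ i)) →
      MaxEntangledIsMinimumBlank ψ) ∧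
    (∀ (G : Type*) [Group G] [Fintype G] (ψ : G → BipState 3), IsGroupShifted ψ →
      MaxEntangledIsMinimumBlank ψ) :=
  ⟨fun ψ hψ hent => maxEntangledIsMinimumBlank_of_necessary ψ fun φ hφ hcl =>
      isMaxEntangledOfRank_of_two_qubit ψ hψ hent φ hφ hcl,
    fun _ _ _ ψ hψ => maxEntangledIsMinimumBlank_of_necessary ψ fun φ hφ hcl =>
      isMaxEntangledOfRank_of_isGroupShifted ψ hψ φ hφ hcl⟩
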